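/- Let $n\ge 0$, $\mathbb{T}^n=(\mathbb{R}/2\pi\mathbb{Z})^n$, $\omega\in\mathbb{R}^n$, and let $A_{j,k}\in\mathbb{C}$ ($1\le j\le n$, $k\in\mathbb{Z}^n$) satisfy $\overline{A_{j,k}}=A_{j,-k}$. Assume that for all $1\le j\le n$ $$\sum_{k\in\mathbb{Z}^n}|A_{j,k}|<\infty\quad\text{and}\quad \sum_{\langle k,\omega\rangle\ne 0}\left|\frac{A_{j,k}}{\langle k,\omega\rangle}\right|<\infty .$$ Then for $1\le j\le n$ and $\phi\in\mathbb{T}^n$ the series $$F^{(1)}_j(\phi)=\sum_{k\in\mathbb{Z}^n}A_{j,k}e^{i\langle k,\phi\rangle},\qquad H^{(1)}_j(\phi)=-\sum_{\langle k,\omega\rangle\neq 0}\frac{A_{j,k}}{i\langle k,\omega\rangle}e^{i\langle k,\phi\rangle},\qquad \overline F^{(1)}_j(\phi)=\sum_{\langle k,\omega\rangle=0}A_{j,k}e^{i\langle k,\phi\rangle}$$ converge unconditionally and define continuous vector fields $\mathbb{T}^n\to\mathbb{R}^n$. The directional derivative $(D_\omega H^{(1)})(\phi)=\frac{d}{dt}\big|_{t=0}H^{(1)}(\phi+t\omega)$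 exists for every $\phi$, and the homological equation $$\overline F^{(1)}(\phi)=F^{(1)}(\phi)+(D_\omega H^{(1)})(\phi)$$ holds on $\mathbb{T}^n$. Let in addition $\varepsilon_0>0$, let $F^{(1)}$ be $C^2$ and $H^{(1)}$ be $C^3$ on $\mathbb{T}^n$, let $R^{(2)}:\mathbb{T}^n\times[-\varepsilon_0,\varepsilon_0]\to\mathbb{R}^n$ be $C^2$, and put $F(\phi,\varepsilon)=\omega+\varepsilon F^{(1)}(\phi)+\varepsilon^2R^{(2)}(\phi,\varepsilon)$. Then $H^{(1)}$ has a unique flow $\Gamma^{s}=\Gamma^{s}_{H^{(1)}}$ on $\mathbb{T}^n$, defined for all $s\in\mathbb{R}$, and: i) The map $(\phi,\varepsilon)\mapsto\Gamma^{\varepsilon}(\phi)$ from $\mathbb{T}^n\times[-\varepsilon_0,\varepsilon_0]$ to $\mathbb{T}^n$ is $C^3$, and for all $\phi\in\mathbb{T}^n$, $|\varepsilon|\le\varepsilon_0$ and $1\le j\le n$ $$\|\Gamma^{\varepsilon}(\phi)_j-\phi_j\|\le|\varepsilon|\,\|H^{(1)}_j\|_0,\qquad \|H^{(1)}_j\|_0:=\sup_{\psi\in\mathbb{T}^n}|H^{(1)}_j(\psi)|,$$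 where $\|\cdot\|$ is the distance to $0$ in $\mathbb{R}/2\pi\mathbb{Z}$. The same bound holds for the displacement in $\mathbb{R}$: if $x:\mathbb{R}\to\mathbb{R}^n$ is a continuous lift of $s\mapsto\Gamma^s(\phi)$, then $|x_j(\varepsilon)-x_j(0)|\le|\varepsilon|\,\|H^{(1)}_j\|_0$. ii) The map $(\phi,\varepsilon)\mapsto(\Gamma^{\varepsilon})_*F(\cdot,\varepsilon)(\phi)$ from $\mathbb{T}^n\times[-\varepsilon_0,\varepsilon_0]$ to $\mathbb{R}^n$ is $C^2$, where $\gamma_*V=(D\gamma\cdot V)\circ\gamma^{-1}$ denotes the pushforward of a vector field, and there is a bounded continuous $\overline R^{(2)}:\mathbb{T}^n\times[-\varepsilon_0,\varepsilon_0]\to\mathbb{R}^n$ such that for all $\phi\in\mathbb{T}^n$ and $|\varepsilon|\le\varepsilon_0$ $$\big((\Gamma^{\varepsilon})_*F(\cdot,\varepsilon)\big)(\phi)=\omega+\varepsilon\overline F^{(1)}(\phi)+\varepsilon^2\,\overline R^{(2)}(\phi,\varepsilon).$$ -/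

import Mathlib

open Set Filter Topology

noncomputable section

namespace PhaseNF

/-- The torus `𝕋ⁿ = (ℝ / 2πℤ)ⁿ`; `Real.Angle` is `ℝ / 2πℤ` with its quotient topology and norm. -/
abbrev Torus (n : ℕ) : Type := Fin n → Real.Angle

/-- The covering map `ℝⁿ → 𝕋ⁿ`. -/
def proj {n : ℕ} (x : Fin n → ℝ) : Torus n := fun i => (x i : Real.Angle)

/-- The chart of `𝕋ⁿ` around `0`: it sends a point to its representative in `(-π, π]ⁿ`, and is a
smooth local inverse of `proj` around `0`. The chart around `a` is `φ ↦ chart (φ - a)`. -/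
def chart {n : ℕ} (φ : Torus n) : Fin n → ℝ := fun i => (φ i).toReal

/-- The pairing `⟨k, ω⟩` of `k ∈ ℤⁿ` and `ω ∈ ℝⁿ`. -/
def pair {n : ℕ} (k : Fin n → ℤ) (ω : Fin n → ℝ) : ℝ := ∑ i, (k i : ℝ) * ω i

/-- The character `φ ↦ e^{i⟨k, φ⟩}` of `𝕋ⁿ`. -/
def char {n : ℕ} (k : Fin n → ℤ) (φ : Torus n) : ℂ :=
  ∏ i, (((φ i).toCircle : Circle) : ℂ) ^ k i

theorem char_proj {n : ℕ} (k : Fin n → ℤ) (x : Fin n → ℝ) :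
    char k (proj x) = Complex.exp (Complex.I * (pair k x : ℂ)) := by
  simp only [char, proj, pair, Real.Angle.toCircle_coe, Circle.coe_exp, ← Complex.exp_int_mul]
  rw [← Complex.exp_sum]
  congr 1
  push_cast
  rw [Finset.mul_sum]
  exact Finset.sum_congr rfl fun i _ => by ring

/-! Smoothness on the torus. -/

/-- `V : 𝕋ⁿ → ℝⁿ` is of class `C^m`. -/
def IsCk {n : ℕ} (m : ℕ) (V : Torus n → Fin n → ℝ) : Prop :=
  ContDiff ℝ m fun x : Fin n → ℝ => V (proj x)

/-- `W : 𝕋ⁿ × I → ℝⁿ` is of class `C^m`. Only the values of `W φ ε` with `ε ∈ I` matter. -/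
def IsCkOn {n : ℕ} (m : ℕ) (W : Torus n → ℝ → Fin n → ℝ) (I : Set ℝ) : Prop :=
  ContDiffOn ℝ m (fun p : (Fin n → ℝ) × ℝ => W (proj p.1) p.2) (univ ×ˢ I)

/-- `g : 𝕋ⁿ × I → 𝕋ⁿ` is of class `C^m`: near each point `p`, it is so in the chart around
`g p`. -/
def IsCkMapOn {n : ℕ} (m : ℕ) (g : Torus n → ℝ → Torus n) (I : Set ℝ) : Prop :=
  ∀ p ∈ (univ ×ˢ I : Set ((Fin n → ℝ) × ℝ)),
    ContDiffWithinAt ℝ m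
      (fun q : (Fin n → ℝ) × ℝ => chart (g (proj q.1) q.2 - g (proj p.1) p.2)) (univ ×ˢ I) p

/-- The supremum norm `‖f‖₀` of a function on the torus. -/
def supNorm {n : ℕ} (f : Torus n → ℝ) : ℝ := ⨆ φ, |f φ|

/-- The derivative `Dγ(φ) : ℝⁿ → ℝⁿ` of a map `γ : 𝕋ⁿ → 𝕋ⁿ`, computed in the charts
around `φ` and `γ φ`. -/
def torusFDeriv {n : ℕ} (γ : Torus n → Torus n) (φ : Torus n) :
    (Fin n → ℝ) →L[ℝ] (Fin n → ℝ) :=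
  fderiv ℝ (fun y : Fin n → ℝ => chart (γ (φ + proj y) - γ φ)) 0

/-- The curve `c : ℝ → 𝕋ⁿ` has velocity `v` at time `s`. -/
def HasVelocityAt {n : ℕ} (c : ℝ → Torus n) (v : Fin n → ℝ) (s : ℝ) : Prop :=
  HasDerivAt (fun t : ℝ => chart (c t - c s)) v s

/-- `Γ` is the flow of the vector field `H`: `∂ₛ Γˢ(φ) = H (Γˢ(φ))`. (A `Flow` satisfies
`Γ⁰ = id` and `Γˢ⁺ᵗ = Γˢ ∘ Γᵗ`, and is continuous on `ℝ × 𝕋ⁿ`.) -/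
def IsFlowOf {n : ℕ} (Γ : Flow ℝ (Torus n)) (H : Torus n → Fin n → ℝ) : Prop :=
  ∀ (φ : Torus n) (s : ℝ), HasVelocityAt (fun t => Γ t φ) (H (Γ s φ)) s

/-- The pushforward `γ_* V = (Dγ · V) ∘ γ⁻¹` of a vector field. -/
def pushforward {n : ℕ} (γ : Torus n ≃ₜ Torus n) (V : Torus n → Fin n → ℝ) :
    Torus n → Fin n → ℝ :=
  fun φ => torusFDeriv γ (γ.symm φ) (V (γ.symm φ))

/-- `V` is differentiable at `φ` in the direction of the constant vector field `ω`. -/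
def DirDifferentiableAt {n : ℕ} (ω : Fin n → ℝ) (V : Torus n → Fin n → ℝ) (φ : Torus n) : Prop :=
  DifferentiableAt ℝ (fun t : ℝ => V (φ + proj (t • ω))) 0

/-- The derivative `(D_ω V)(φ)` of `V` at `φ` in the direction of the constant vector
field `ω`. -/
def dirDeriv {n : ℕ} (ω : Fin n → ℝ) (V : Torus n → Fin n → ℝ) (φ : Torus n) : Fin n → ℝ :=
  deriv (fun t : ℝ => V (φ + proj (t • ω))) 0

/-! The vector fields with Fourier coefficients `A j k`. Each component is the real part of the
complex Fourier sum, which is itself real when `A j (-k)` is the conjugate of `A j k`. -/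

/-- `F⁽¹⁾_j(φ) = ∑_k A_{j,k} e^{i⟨k,φ⟩}`. -/
def fieldF {n : ℕ} (A : Fin n → (Fin n → ℤ) → ℂ) (φ : Torus n) : Fin n → ℝ :=
  fun j => (∑' k : Fin n → ℤ, A j k * char k φ).re

/-- `H⁽¹⁾_j(φ) = -∑_{⟨k,ω⟩ ≠ 0} A_{j,k} / (i⟨k,ω⟩) e^{i⟨k,φ⟩}`. -/
def fieldH {n : ℕ} (ω : Fin n → ℝ) (A : Fin n → (Fin n → ℤ) → ℂ) (φ : Torus n) : Fin n → ℝ :=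
  fun j => (-∑' k : {k : Fin n → ℤ // pair k ω ≠ 0},
    A j k / (Complex.I * (pair k.1 ω : ℂ)) * char k.1 φ).re

/-- The resonant part `F̄⁽¹⁾_j(φ) = ∑_{⟨k,ω⟩ = 0} A_{j,k} e^{i⟨k,φ⟩}`. -/
def fieldFbar {n : ℕ} (ω : Fin n → ℝ) (A : Fin n → (Fin n → ℤ) → ℂ) (φ : Torus n) : Fin n → ℝ :=
  fun j => (∑' k : {k : Fin n → ℤ // pair k ω = 0}, A j k * char k.1 φ).re

end PhaseNF

end

/-! The three series converge absolutely because characters have modulus one, and pairing `k` with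
`-k` makes their sums real. Translation by `t • ω` multiplies the `k`-th term by `exp (i t ⟨k, ω⟩)`,
so `D_ω` multiplies its coefficient by `i ⟨k, ω⟩`. The coefficients of `H` are chosen so that this
cancels the nonresonant part of `F` and leaves the resonant part untouched (`coeffH_mul`,
`hasDerivAt_fourierRe`): this is the homological equation.

Everything about the flow is done on `ℝⁿ`, where the lifted field is periodic, hence bounded and
Lipschitz. Picard–Lindelöf gives a global flow `Φ` (`exists_isGlobalFlow`). The implicit function
theorem, applied to the integral equation in the space of curves on `[0, 1]`, makes `Φ` jointly
`C^m` (`IsGlobalFlow.contDiff`). Every curve in the torus with velocity `H` is the projection of a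
curve of `Φ` (`curve_eq_proj`); this gives uniqueness and transfers regularity. The displacement
bound is the mean value inequality.

For the normal form, the pushforward of `ω + ε F` is `C²` in `ε` and is expanded at `ε = 0` with
integral remainder. Its value there is `ω`, and its derivative is `F` plus the derivative of the
pushforward of `ω`. The latter is `D_ω H`, by symmetry of the second derivative of `Φ`
(`IsFlowOf.hasDerivAt_pushforward_const`), so the homological equation turns the sum into the
resonant part. -/

noncomputable section

namespace PhaseNF

/-! ### Global flows of bounded Lipschitz fields and their joint smoothness in point and time. -/

section Flow

/-- Pointwise application of a continuous family of continuous linear maps. -/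
def pointwiseApply (K : Type) [TopologicalSpace K] [CompactSpace K] (E F : Type)
    [NormedAddCommGroup E] [NormedSpace ℝ E] [NormedAddCommGroup F] [NormedSpace ℝ F] :
    C(K, E →L[ℝ] F) →L[ℝ] C(K, E) →L[ℝ] C(K, F) :=
  LinearMap.mkContinuous₂
    (LinearMap.mk₂ ℝ (fun (A : C(K, E →L[ℝ] F)) (u : C(K, E)) =>
        (⟨fun k => A k (u k), by fun_prop⟩ : C(K, F)))
      (fun _ _ _ => by ext; simp) (fun _ _ _ => by ext; simp)
      (fun _ _ _ => by ext; simp) (fun _ _ _ => by ext; simp)) 1 (by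
    intro A u
    rw [one_mul, ContinuousMap.norm_le _ (by positivity)]
    intro k
    exact ((A k).le_opNorm _).trans
      (mul_le_mul (A.norm_coe_le_norm k) (u.norm_coe_le_norm k) (norm_nonneg _)
        (norm_nonneg A)))

@[simp] theorem pointwiseApply_apply {K : Type} [TopologicalSpace K] [CompactSpace K] {E F : Type}
    [NormedAddCommGroup E] [NormedSpace ℝ E] [NormedAddCommGroup F] [NormedSpace ℝ F]
    (A : C(K, E →L[ℝ] F)) (u : C(K, E)) (k : K) : pointwiseApply K E F A u k = A k (u k) := rfl

/-- The mean value inequality is applied on each segment from `u k` to `v k`. The estimate is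
uniform in `k` because `v ↦ Dh.comp v` is continuous for the sup norm, `K` being compact. -/
theorem hasFDerivAt_comp_left {K : Type} [TopologicalSpace K] [CompactSpace K] {E F : Type}
    [NormedAddCommGroup E] [NormedSpace ℝ E] [NormedAddCommGroup F] [NormedSpace ℝ F]
    (h : C(E, F)) (Dh : C(E, E →L[ℝ] F)) (hd : ∀ x, HasFDerivAt h (Dh x) x) (u : C(K, E)) :
    HasFDerivAt (fun v : C(K, E) => h.comp v) (pointwiseApply K E F (Dh.comp u)) u := by
  rw [hasFDerivAt_iff_isLittleO, Asymptotics.isLittleO_iff]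
  intro c hc
  have hcont : ContinuousAt (fun v : C(K, E) => Dh.comp v) u :=
    (ContinuousMap.continuous_postcomp Dh).continuousAt
  obtain ⟨δ, hδ, hball⟩ := (Metric.continuousAt_iff (α := C(K, E)) (β := C(K, E →L[ℝ] F))).1 hcont c hc
  filter_upwards [Metric.ball_mem_nhds u hδ] with v hv
  rw [ContinuousMap.norm_le _ (by positivity)]
  intro k
  have key := (convex_segment (𝕜 := ℝ) (u k) (v k)).norm_image_sub_le_of_norm_hasFDerivWithin_le'
    (f := h) (f' := Dh) (φ := Dh (u k)) (C := c) (fun y _ => (hd y).hasFDerivWithinAt) ?_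
    (left_mem_segment ℝ _ _) (right_mem_segment ℝ _ _)
  · refine key.trans (mul_le_mul_of_nonneg_left ?_ hc.le)
    exact (v - u).norm_coe_le_norm k
  · intro y hy
    obtain ⟨a, b, ha, hb, hab, rfl⟩ := hy
    have hmem : a • u + b • v ∈ Metric.ball u δ :=
      (convex_ball u δ) (Metric.mem_ball_self hδ) hv ha hb hab
    have h1 := hball hmem
    rw [← dist_eq_norm]
    exact (ContinuousMap.dist_apply_le_dist (f := Dh.comp (a • u + b • v))
      (g := Dh.comp u) k).trans h1.le

/-- Composition with a `C^m` map is a `C^m` map between spaces of continuous functions. -/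
theorem contDiff_comp_left {K : Type} [TopologicalSpace K] [CompactSpace K] {E : Type}
    [NormedAddCommGroup E] [NormedSpace ℝ E] (m : ℕ) :
    ∀ {F : Type} [NormedAddCommGroup F] [NormedSpace ℝ F] (h : C(E, F)), ContDiff ℝ m h →
      ContDiff ℝ m (fun v : C(K, E) => h.comp v) := by
  -- `F` is quantified after `m`: the induction hypothesis is needed for `fderiv ℝ h`, whose values
  -- lie in `E →L[ℝ] F`.
  induction m with
  | zero =>
    intro F _ _ h _
    exact contDiff_zero.2 (ContinuousMap.continuous_postcomp h)
  | succ m ih =>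
    intro F _ _ h hh
    have hc : Continuous (fderiv ℝ h) := hh.continuous_fderiv (by simp)
    have hd := hasFDerivAt_comp_left (K := K) h ⟨fderiv ℝ h, hc⟩
      fun x => (hh.differentiable (by simp) x).hasFDerivAt
    push_cast at hh ⊢
    rw [contDiff_succ_iff_fderiv] at hh ⊢
    refine ⟨fun u => (hd u).differentiableAt, by simp, ?_⟩
    have : fderiv ℝ (fun v : C(K, E) => h.comp v) = fun u =>
        pointwiseApply K E F ((⟨fderiv ℝ h, hc⟩ : C(E, E →L[ℝ] F)).comp u) :=
      funext fun u => (hd u).fderiv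
    rw [this]
    exact (pointwiseApply K E F).contDiff.comp (ih ⟨fderiv ℝ h, hc⟩ hh.2.2)

/-- The primitive vanishing at `0` of a continuous function on the unit interval. -/
def primitive (E : Type) [NormedAddCommGroup E] [NormedSpace ℝ E] :
    C(unitInterval, E) →L[ℝ] C(unitInterval, E) :=
  LinearMap.mkContinuous
    { toFun := fun u =>
        ⟨fun t => ∫ s in (0 : ℝ)..t, IccExtend zero_le_one u s, by
          exact (intervalIntegral.continuous_primitive
            (fun a b => (u.continuous.Icc_extend').intervalIntegrable a b) 0).comp
              continuous_subtype_val⟩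
      map_add' := fun u v => by
        ext t
        exact intervalIntegral.integral_add (u.continuous.Icc_extend'.intervalIntegrable _ _)
          (v.continuous.Icc_extend'.intervalIntegrable _ _)
      map_smul' := fun c u => by
        ext t
        exact intervalIntegral.integral_smul c _ } 1 (by
    intro u
    rw [one_mul, ContinuousMap.norm_le _ (by positivity)]
    intro t
    refine (intervalIntegral.norm_integral_le_of_norm_le_const (C := ‖u‖)
      fun s _ => u.norm_coe_le_norm _).trans ?_
    rw [sub_zero, abs_of_nonneg t.2.1]
    exact mul_le_of_le_one_right (norm_nonneg _) t.2.2)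

theorem primitive_apply {E : Type} [NormedAddCommGroup E] [NormedSpace ℝ E]
    (u : C(unitInterval, E)) (t : unitInterval) :
    primitive E u t = ∫ s in (0 : ℝ)..t, IccExtend zero_le_one u s := rfl

theorem norm_primitive_le (E : Type) [NormedAddCommGroup E] [NormedSpace ℝ E] :
    ‖primitive E‖ ≤ 1 := LinearMap.mkContinuous_norm_le _ zero_le_one _


/-- `Φ x` is the integral curve of `h` starting at `x`. -/
structure IsGlobalFlow {E : Type} [NormedAddCommGroup E] [NormedSpace ℝ E] (h : E → E)
    (Φ : E → ℝ → E) : Prop where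
  zero : ∀ x, Φ x 0 = x
  deriv : ∀ x t, HasDerivAt (Φ x) (h (Φ x t)) t

variable {E : Type} [NormedAddCommGroup E] [NormedSpace ℝ E] {h : E → E} {K : NNReal}

theorem integralCurve_unique (hK : LipschitzWith K h) {f g : ℝ → E} {t₀ : ℝ}
    (hf : ∀ t, HasDerivAt f (h (f t)) t) (hg : ∀ t, HasDerivAt g (h (g t)) t)
    (heq : f t₀ = g t₀) : f = g :=
  ODE_solution_unique_univ (v := fun _ => h) (s := fun _ => univ) (K := K)
    (fun _ => hK.lipschitzOnWith) (fun t => ⟨hf t, trivial⟩) (fun t => ⟨hg t, trivial⟩) heq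

theorem IsGlobalFlow.eq_curve {Φ : E → ℝ → E} (hΦ : IsGlobalFlow h Φ) (hK : LipschitzWith K h)
    {f : ℝ → E} (hf : ∀ t, HasDerivAt f (h (f t)) t) : f = Φ (f 0) :=
  integralCurve_unique hK hf (hΦ.deriv _) (hΦ.zero _).symm (t₀ := 0)

theorem IsGlobalFlow.add {Φ : E → ℝ → E} (hΦ : IsGlobalFlow h Φ) (hK : LipschitzWith K h)
    (x : E) (s t : ℝ) : Φ x (s + t) = Φ (Φ x s) t := by
  have := hΦ.eq_curve hK (f := fun t => Φ x (s + t)) fun t => by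
    simpa using (hΦ.deriv x (s + t)).comp_const_add s t
  simpa using congrFun this t

theorem exists_isGlobalFlow [CompleteSpace E] (hK : LipschitzWith K h) {M : NNReal}
    (hM : ∀ x, ‖h x‖ ≤ M) : ∃ Φ, IsGlobalFlow h Φ := by
  have hex : ∀ (x : E) (T : NNReal), ∃ α : ℝ → E, α 0 = x ∧
      ∀ t ∈ Ioo (-(T : ℝ)) T, HasDerivAt α (h (α t)) t := by
    intro x T
    -- At speed at most `M`, a curve stays within `M * T` of its start up to time `T`, so this
    -- radius serves for every `T`.
    have hPL : IsPicardLindelof (fun _ : ℝ => h) (tmin := -(T : ℝ)) (tmax := T)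
        ⟨0, by simp⟩ x (M * T) 0 M K :=
      { lipschitzOnWith := fun _ _ => hK.lipschitzOnWith
        continuousOn := fun _ _ => continuousOn_const
        norm_le := fun _ _ x _ => hM x
        mul_max_le := by simp }
    obtain ⟨α, h0, hα⟩ := hPL.exists_eq_forall_mem_Icc_hasDerivWithinAt₀
    exact ⟨α, h0, fun t ht => (hα t (Ioo_subset_Icc_self ht)).hasDerivAt (Icc_mem_nhds ht.1 ht.2)⟩
  choose α h0 hα using hex
  have hagree : ∀ x (S T : NNReal) (t : ℝ), S ≤ T → t ∈ Ioo (-(S : ℝ)) S → α x S t = α x T t := by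
    intro x S T t hST ht
    have hS : (0 : ℝ) < S := by
      have := ht.1.trans ht.2
      linarith
    have hST' : (S : ℝ) ≤ T := hST
    refine ODE_solution_unique_of_mem_Ioo (v := fun _ => h) (s := fun _ => univ) (K := K)
      (a := -S) (b := S) (t₀ := 0) (fun _ _ => hK.lipschitzOnWith) ⟨by linarith, hS⟩
      (fun t ht => ⟨hα x S t ht, trivial⟩)
      (fun t ht => ⟨hα x T t ⟨by linarith [ht.1], by linarith [ht.2]⟩, trivial⟩)
      ((h0 x S).trans (h0 x T).symm) ht
  -- The extra `1` puts `t` strictly inside the interval of existence; `hagree` glues the solutions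
  -- of different lengths.
  refine ⟨fun x t => α x (‖t‖₊ + 1) t, fun x => h0 x _, fun x t => ?_⟩
  have hmem : ∀ t : ℝ, t ∈ Ioo (-((‖t‖₊ + 1 : NNReal) : ℝ)) ((‖t‖₊ + 1 : NNReal) : ℝ) := by
    intro t
    push_cast
    rw [Real.norm_eq_abs, mem_Ioo, ← abs_lt]
    linarith
  have ht := hmem t
  refine (hα x _ t ht).congr_of_eventuallyEq ?_
  filter_upwards [Ioo_mem_nhds ht.1 ht.2] with s hs
  rcases le_total ‖s‖₊ ‖t‖₊ with hle | hle
  · exact hagree x _ _ s (by gcongr) (hmem s)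
  · exact (hagree x _ _ s (by gcongr) hs).symm

/-- The integral equation of the curve `u` on `[0, 1]` starting at `x` with velocity `ε h`. -/
def volterra (h : C(E, E)) (p : (E × ℝ) × C(unitInterval, E)) : C(unitInterval, E) :=
  p.2 - (ContinuousLinearMap.const ℝ unitInterval p.1.1 + p.1.2 • primitive E (h.comp p.2))

theorem contDiff_volterra (h : C(E, E)) {m : ℕ} (hm : ContDiff ℝ m h) :
    ContDiff ℝ m (volterra h) := by
  have h1 : ContDiff ℝ m fun p : (E × ℝ) × C(unitInterval, E) => h.comp p.2 :=
    (contDiff_comp_left m h hm).comp contDiff_snd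
  have h2 : ContDiff ℝ m fun p : (E × ℝ) × C(unitInterval, E) => primitive E (h.comp p.2) :=
    (primitive E).contDiff.comp h1
  have h3 : ContDiff ℝ m fun p : (E × ℝ) × C(unitInterval, E) =>
      ContinuousLinearMap.const ℝ unitInterval p.1.1 :=
    (ContinuousLinearMap.const ℝ unitInterval : E →L[ℝ] C(unitInterval, E)).contDiff.comp
      (contDiff_fst.comp contDiff_fst)
  have h4 : ContDiff ℝ m fun p : (E × ℝ) × C(unitInterval, E) => p.1.2 :=
    contDiff_snd.comp contDiff_fst
  exact contDiff_snd.sub (h3.add (h4.smul h2))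

/-- For `|ε| K < 1` the integral operator is a contraction, so it has at most one fixed point. -/
theorem volterra_eq_zero_unique (h : C(E, E)) (hK : LipschitzWith K h) {p : E × ℝ}
    (hp : |p.2| * K < 1) {u v : C(unitInterval, E)} (hu : volterra h (p, u) = 0)
    (hv : volterra h (p, v) = 0) : u = v := by
  have e : u - v = p.2 • primitive E (h.comp u - h.comp v) := by
    rw [volterra, sub_eq_zero] at hu hv
    dsimp only at hu hv
    rw [map_sub]
    nth_rw 1 [hu, hv]
    module
  have e1 : ‖h.comp u - h.comp v‖ ≤ K * ‖u - v‖ := by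
    rw [ContinuousMap.norm_le _ (by positivity)]
    intro t
    exact (hK.norm_sub_le (u t) (v t)).trans
      (mul_le_mul_of_nonneg_left ((u - v).norm_coe_le_norm t) K.2)
  have e2 : ‖u - v‖ ≤ (|p.2| * K) * ‖u - v‖ := by
    calc ‖u - v‖ = |p.2| * ‖primitive E (h.comp u - h.comp v)‖ := by
          conv_lhs => rw [e]
          rw [norm_smul, Real.norm_eq_abs]
      _ ≤ |p.2| * (1 * (K * ‖u - v‖)) := by
          gcongr
          exact ((primitive E).le_of_opNorm_le (norm_primitive_le E) _).trans (by gcongr)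
      _ = _ := by ring
  have : ‖u - v‖ = 0 := by nlinarith [norm_nonneg (u - v)]
  exact sub_eq_zero.1 (norm_eq_zero.1 this)

theorem IsGlobalFlow.volterra_eq_zero [CompleteSpace E] {h : C(E, E)} {Φ : E → ℝ → E}
    (hΦ : IsGlobalFlow h Φ) (x : E) (ε : ℝ) (u : C(unitInterval, E))
    (hu : ∀ t : unitInterval, u t = Φ x (ε * t)) : volterra h ((x, ε), u) = 0 := by
  have hd : ∀ t : ℝ, HasDerivAt (fun t => Φ x (ε * t)) (ε • h (Φ x (ε * t))) t := fun t =>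
    (hΦ.deriv x (ε * t)).scomp t (by simpa using (hasDerivAt_id t).const_mul ε)
  have hc : Continuous fun t => Φ x (ε * t) :=
    continuous_iff_continuousAt.2 fun t => (hd t).continuousAt
  ext t
  have hi := intervalIntegral.integral_eq_sub_of_hasDerivAt (a := 0) (b := (t : ℝ))
    (fun t _ => hd t) ((h.continuous.comp hc).const_smul ε |>.intervalIntegrable _ _)
  rw [intervalIntegral.integral_smul, mul_zero, hΦ.zero] at hi
  have hJ : primitive E (h.comp u) t = ∫ s in (0 : ℝ)..t, h (Φ x (ε * s)) := by
    rw [primitive_apply]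
    refine intervalIntegral.integral_congr fun s hs => ?_
    rw [uIcc_of_le t.2.1] at hs
    have hs' : s ∈ Icc (0 : ℝ) 1 := ⟨hs.1, hs.2.trans t.2.2⟩
    rw [IccExtend_of_mem _ _ hs']
    simp [hu]
  simp only [volterra, ContinuousMap.sub_apply, ContinuousMap.add_apply, ContinuousMap.smul_apply,
    hJ, hi, hu]
  change Φ x (ε * t) - (x + (Φ x (ε * t) - x)) = 0
  abel

theorem fderiv_volterra_inr (h : C(E, E)) (hh : ContDiff ℝ 1 h)
    (p : (E × ℝ) × C(unitInterval, E)) :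
    fderiv ℝ (volterra h) p ∘L .inr ℝ (E × ℝ) C(unitInterval, E) =
      1 - p.1.2 • primitive E ∘L pointwiseApply unitInterval E E
        ((⟨fderiv ℝ h, hh.continuous_fderiv (by simp)⟩ : C(E, E →L[ℝ] E)).comp p.2) := by
  have h1 : HasFDerivAt (volterra h) (fderiv ℝ (volterra h) p) (p.1, p.2) :=
    ((contDiff_volterra h hh).differentiable (by simp) p).hasFDerivAt
  have h2 := h1.comp p.2 (hasFDerivAt_prodMk_right (𝕜 := ℝ) p.1 p.2)
  have h3 := hasFDerivAt_comp_left h ⟨fderiv ℝ h, hh.continuous_fderiv (by simp)⟩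
    (fun x => (hh.differentiable (by simp) x).hasFDerivAt) p.2
  have h4 := (hasFDerivAt_id (𝕜 := ℝ) p.2).sub ((((primitive E).hasFDerivAt.comp p.2 h3).const_smul
    p.1.2).const_add (ContinuousLinearMap.const ℝ unitInterval p.1.1))
  exact h2.unique h4

/-- The partial derivative in the curve is the identity minus an operator of norm at most `|ε| K <
1`, hence invertible by the Neumann series. -/
theorem isInvertible_fderiv_volterra [CompleteSpace E] (h : C(E, E)) (hh : ContDiff ℝ 1 h)
    (hK : LipschitzWith K h) (p : (E × ℝ) × C(unitInterval, E)) (hp : |p.1.2| * K < 1) :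
    (fderiv ℝ (volterra h) p ∘L .inr ℝ (E × ℝ) C(unitInterval, E)).IsInvertible := by
  rw [fderiv_volterra_inr h hh]
  set D : C(E, E →L[ℝ] E) := ⟨fderiv ℝ h, hh.continuous_fderiv (by simp)⟩
  have hlt : ‖p.1.2 • primitive E ∘L pointwiseApply unitInterval E E (D.comp p.2)‖ < 1 := by
    refine lt_of_le_of_lt (ContinuousLinearMap.opNorm_le_bound _ (by positivity) fun v => ?_) hp
    have e1 : ‖pointwiseApply unitInterval E E (D.comp p.2) v‖ ≤ K * ‖v‖ := by
      rw [ContinuousMap.norm_le _ (by positivity)]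
      intro t
      rw [pointwiseApply_apply]
      refine ((D.comp p.2 t).le_opNorm _).trans ?_
      gcongr
      · exact norm_fderiv_le_of_lipschitz ℝ hK
      · exact v.norm_coe_le_norm t
    calc ‖p.1.2 • primitive E (pointwiseApply unitInterval E E (D.comp p.2) v)‖
        = |p.1.2| * ‖primitive E (pointwiseApply unitInterval E E (D.comp p.2) v)‖ := by
          rw [norm_smul, Real.norm_eq_abs]
      _ ≤ |p.1.2| * (1 * (K * ‖v‖)) := by
          gcongr
          exact ((primitive E).le_of_opNorm_le (norm_primitive_le E) _).trans (by gcongr)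
      _ = _ := by ring
  exact ⟨ContinuousLinearEquiv.unitsEquiv ℝ C(unitInterval, E) (Units.oneSub
    (p.1.2 • primitive E ∘L pointwiseApply unitInterval E E (D.comp p.2)) hlt), by ext; rfl⟩

theorem IsGlobalFlow.continuous_curve {Φ : E → ℝ → E} (hΦ : IsGlobalFlow h Φ) (x : E) :
    Continuous (Φ x) :=
  continuous_iff_continuousAt.2 fun t => (hΦ.deriv x t).continuousAt

/-- Rescaling time to `[0, 1]` makes the time `ε` a parameter alongside the initial point. The curve
then depends smoothly on both by the implicit function theorem, and evaluation at `1` recovers `Φ`.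
-/
theorem IsGlobalFlow.contDiffAt_of_small [CompleteSpace E] {Φ : E → ℝ → E}
    (hΦ : IsGlobalFlow h Φ) (hK : LipschitzWith K h) {m : ℕ} (hm : 1 ≤ m) (hh : ContDiff ℝ m h)
    (p : E × ℝ) (hp : |p.2| * K < 1) : ContDiffAt ℝ m (fun q : E × ℝ => Φ q.1 q.2) p := by
  let H : C(E, E) := ⟨h, hK.continuous⟩
  let u : E × ℝ → C(unitInterval, E) := fun q =>
    ⟨fun t => Φ q.1 (q.2 * t), (hΦ.continuous_curve q.1).comp (by fun_prop)⟩
  have hu : ∀ q, volterra H (q, u q) = 0 := fun q =>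
    IsGlobalFlow.volterra_eq_zero (h := H) hΦ q.1 q.2 (u q) fun _ => rfl
  have hcd : ContDiffAt ℝ m (volterra H) (p, u p) := (contDiff_volterra H hh).contDiffAt
  have hm0 : (m : WithTop ℕ∞) ≠ 0 := by
    norm_cast
    omega
  have hinv := isInvertible_fderiv_volterra H (hh.of_le (by exact_mod_cast hm)) hK (p, u p) hp
  have hψ := hcd.contDiffAt_implicitFunction hm0 hinv
  have hsmall : ∀ᶠ q : E × ℝ in 𝓝 p, |q.2| * K < 1 :=
    (by fun_prop : Continuous fun q : E × ℝ => |q.2| * K).continuousAt.eventually_lt_const hp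
  -- No continuity of `u` is assumed: it agrees with the implicit function because both solve the
  -- equation, whose solution is unique for small times.
  have heq : u =ᶠ[𝓝 p] hcd.implicitFunction hm0 hinv := by
    filter_upwards [hsmall, hcd.eventually_apply_implicitFunction hm0 hinv] with q hq hq'
    exact volterra_eq_zero_unique H hK hq (hu q) (hq'.trans (hu p))
  have hu' : ContDiffAt ℝ m u p := hψ.congr_of_eventuallyEq heq
  have := (ContinuousMap.evalCLM ℝ (1 : unitInterval)).contDiff.contDiffAt.comp p hu'
  refine this.congr_of_eventuallyEq (Eventually.of_forall fun q => ?_)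
  simp [u]

/-- The flow of a `C^m` Lipschitz vector field is jointly `C^m`. -/
theorem IsGlobalFlow.contDiff [CompleteSpace E] {Φ : E → ℝ → E}
    (hΦ : IsGlobalFlow h Φ) (hK : LipschitzWith K h) {m : ℕ} (hm : 1 ≤ m) (hh : ContDiff ℝ m h) :
    ContDiff ℝ m (fun q : E × ℝ => Φ q.1 q.2) := by
  have key : ∀ (N : ℕ) (p : E × ℝ), |p.2| * K < N + 1 →
      ContDiffAt ℝ m (fun q : E × ℝ => Φ q.1 q.2) p := by
    intro N
    induction N with
    | zero => exact fun p hp => hΦ.contDiffAt_of_small hK hm hh p (by simpa using hp)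
    | succ N ih =>
      intro p hp
      push_cast at hp
      have hN : (0 : ℝ) < N + 2 := by positivity
      -- The time is split in the ratio `N + 1` to `1`; if `|ε| K < N + 2`, both pieces fall under
      -- the induction hypothesis.
      have e : (fun q : E × ℝ => Φ q.1 q.2) = (fun q : E × ℝ => Φ q.1 q.2) ∘ fun q : E × ℝ =>
          (Φ q.1 ((N + 1) / (N + 2) * q.2), 1 / (N + 2) * q.2) := by
        funext q
        simp only [Function.comp]
        rw [← hΦ.add hK]
        congr 1
        field_simp
        ring
      have habs : ∀ c : ℝ, 0 ≤ c → |c * p.2| * K = c * (|p.2| * K) := fun c hc => by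
        rw [abs_mul, abs_of_nonneg hc, mul_assoc]
      rw [e]
      refine ContDiffAt.comp p (ih _ ?_) (ContDiffAt.prodMk (ContDiffAt.comp p
        (g := fun q : E × ℝ => Φ q.1 q.2) (f := fun q : E × ℝ => (q.1, (N + 1) / (N + 2) * q.2))
        (ih _ ?_) (by fun_prop)) (by fun_prop))
      · dsimp only
        rw [habs _ (by positivity), div_mul_eq_mul_div, div_lt_iff₀ hN]
        nlinarith
      · dsimp only
        rw [habs _ (by positivity), div_mul_eq_mul_div, div_lt_iff₀ hN]
        nlinarith
  refine contDiff_iff_contDiffAt.2 fun p => ?_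
  obtain ⟨N, hN⟩ := exists_nat_gt (|p.2| * K)
  exact key N p (by linarith)

end Flow

/-! ### Fourier series on the torus and the homological equation. -/

section Fourier

variable {n : ℕ}

theorem norm_char (k : Fin n → ℤ) (φ : Torus n) : ‖char k φ‖ = 1 := by
  rw [char, norm_prod]
  exact Finset.prod_eq_one fun i _ => by rw [norm_zpow, Circle.norm_coe, one_zpow]

theorem char_neg (k : Fin n → ℤ) (φ : Torus n) : char (-k) φ = (starRingEnd ℂ) (char k φ) := by
  simp only [char, map_prod, map_zpow₀, Pi.neg_apply]
  refine Finset.prod_congr rfl fun i _ => ?_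
  rw [← Circle.coe_inv_eq_conj, Circle.coe_inv, inv_zpow, zpow_neg]

theorem char_add (k : Fin n → ℤ) (φ ψ : Torus n) : char k (φ + ψ) = char k φ * char k ψ := by
  simp [char, Real.Angle.toCircle_add, mul_zpow, Finset.prod_mul_distrib]

theorem continuous_char (k : Fin n → ℤ) : Continuous (char k : Torus n → ℂ) := by
  refine continuous_finsetProd _ fun i _ => ?_
  have h : Continuous fun φ : Torus n => (((φ i).toCircle : Circle) : ℂ) := by
    simp_rw [Real.Angle.coe_toCircle]
    have := Real.Angle.continuous_cos
    have := Real.Angle.continuous_sin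
    fun_prop
  exact h.zpow₀ (k i) fun φ => Or.inl (Circle.coe_ne_zero _)

theorem pair_neg (k : Fin n → ℤ) (ω : Fin n → ℝ) : pair (-k) ω = -pair k ω := by
  simp [pair]

theorem pair_smul (k : Fin n → ℤ) (t : ℝ) (ω : Fin n → ℝ) : pair k (t • ω) = t * pair k ω := by
  simp only [pair, Pi.smul_apply, smul_eq_mul, Finset.mul_sum]
  exact Finset.sum_congr rfl fun i _ => by ring

/-- The real part of the Fourier series with coefficients `c`. -/
def fourierRe (c : (Fin n → ℤ) → ℂ) (φ : Torus n) : ℝ := (∑' k, c k * char k φ).re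

variable {c : (Fin n → ℤ) → ℂ}

theorem summable_fourier (hc : Summable fun k => ‖c k‖) (φ : Torus n) :
    Summable fun k => c k * char k φ :=
  Summable.of_norm (by simpa [norm_char] using hc)

theorem hasSum_fourierRe (hreal : ∀ k, (starRingEnd ℂ) (c k) = c (-k))
    (hc : Summable fun k => ‖c k‖) (φ : Torus n) :
    HasSum (fun k => c k * char k φ) (fourierRe c φ : ℂ) := by
  have h := (summable_fourier hc φ).hasSum
  have hconj : (starRingEnd ℂ) (∑' k, c k * char k φ) = ∑' k, c k * char k φ := by
    rw [Complex.conj_tsum, ← (Equiv.neg (Fin n → ℤ)).tsum_eq]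
    refine tsum_congr fun k => ?_
    simp [hreal, char_neg]
  rwa [fourierRe, Complex.conj_eq_iff_re.1 hconj]

theorem continuous_fourierRe (hc : Summable fun k => ‖c k‖) :
    Continuous (fourierRe c : Torus n → ℝ) :=
  Complex.continuous_re.comp <| continuous_tsum
    (fun k => continuous_const.mul (continuous_char k)) hc fun k φ => by simp [norm_char]

/-- Termwise differentiation is allowed because the norm of each differentiated term does not depend
on `t`, so `hc'` provides a summable majorant. -/
theorem hasDerivAt_fourierRe (ω : Fin n → ℝ) (hc : Summable fun k => ‖c k‖)
    (hc' : Summable fun k => ‖c k * (Complex.I * (pair k ω : ℂ))‖) (φ : Torus n) :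
    HasDerivAt (fun t : ℝ => fourierRe c (φ + proj (t • ω)))
      (fourierRe (fun k => c k * (Complex.I * (pair k ω : ℂ))) φ) 0 := by
  have hE : ∀ (k : Fin n → ℤ) (t : ℝ), c k * char k (φ + proj (t • ω)) =
      c k * char k φ * Complex.exp (t * (Complex.I * (pair k ω : ℂ))) := by
    intro k t
    rw [char_add, char_proj, pair_smul]
    push_cast
    ring_nf
  have hexp : ∀ (k : Fin n → ℤ) (t : ℝ),
      ‖Complex.exp (t * (Complex.I * (pair k ω : ℂ)))‖ = 1 := by
    intro k t
    rw [show (t : ℂ) * (Complex.I * (pair k ω : ℂ)) = ((t * pair k ω : ℝ) : ℂ) * Complex.I by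
      push_cast; ring, Complex.norm_exp_ofReal_mul_I]
  have hd := hasDerivAt_tsum (𝕜 := ℝ) (F := ℂ) (y₀ := 0)
    (g := fun k t => c k * char k (φ + proj (t • ω)))
    (g' := fun k t => c k * char k φ * (Complex.exp (t * (Complex.I * (pair k ω : ℂ))) *
      (Complex.I * (pair k ω : ℂ)))) hc' (fun k t => by
        simp_rw [hE]
        refine HasDerivAt.const_mul _ ?_
        have h1 : HasDerivAt (fun t : ℝ => (t : ℂ) * (Complex.I * (pair k ω : ℂ)))
            (Complex.I * (pair k ω : ℂ)) t := by
          simpa using (Complex.ofRealCLM.hasDerivAt (x := t)).mul_const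
            (Complex.I * (pair k ω : ℂ))
        exact h1.cexp)
      (fun k t => by
        rw [norm_mul, norm_mul, norm_mul (Complex.exp _), hexp, norm_char, norm_mul (c k)]
        simp)
      (summable_fourier hc _) 0
  have hre := Complex.reCLM.hasFDerivAt.comp_hasDerivAt (0 : ℝ) hd
  refine hre.congr_deriv ?_
  simp only [fourierRe, Complex.reCLM_apply]
  congr 1
  refine tsum_congr fun k => ?_
  simp only [Complex.ofReal_zero, zero_mul, Complex.exp_zero, one_mul]
  ring

/-- The Fourier coefficients of `fieldH`. -/
def coeffH (ω : Fin n → ℝ) (c : (Fin n → ℤ) → ℂ) (k : Fin n → ℤ) : ℂ :=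
  -(c k / (Complex.I * (pair k ω : ℂ)))

/-- The Fourier coefficients of `fieldFbar`. -/
def coeffFbar (ω : Fin n → ℝ) (c : (Fin n → ℤ) → ℂ) : (Fin n → ℤ) → ℂ :=
  {k | pair k ω = 0}.indicator c

/-- Division by zero gives zero, so `coeffH` vanishes at resonant `k`, and the series may be summed
over all of `ℤⁿ`. -/
theorem hasSum_subtype_coeffH {ω : Fin n → ℝ} {φ : Torus n} {s : ℂ} :
    HasSum (fun k : {k : Fin n → ℤ // pair k ω ≠ 0} =>
      -(c k / (Complex.I * (pair k.1 ω : ℂ)) * char k.1 φ)) s ↔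
    HasSum (fun k => coeffH ω c k * char k φ) s := by
  have := hasSum_subtype_iff_of_support_subset (a := s)
    (f := fun k => coeffH ω c k * char k φ) (s := {k | pair k ω ≠ 0}) (by
      intro k hk
      contrapose! hk
      simp only [mem_ofPred_eq, not_not] at hk
      simp [coeffH, hk])
  rw [← this]
  simp only [coeffH, neg_mul]
  rfl

theorem hasSum_subtype_coeffFbar {ω : Fin n → ℝ} {φ : Torus n} {s : ℂ} :
    HasSum (fun k : {k : Fin n → ℤ // pair k ω = 0} => c k * char k.1 φ) s ↔
    HasSum (fun k => coeffFbar ω c k * char k φ) s := by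
  have := hasSum_subtype_iff_indicator (a := s)
    (f := fun k => c k * char k φ) (s := {k | pair k ω = 0})
  have h2 : ({k | pair k ω = 0} : Set (Fin n → ℤ)).indicator (fun k => c k * char k φ) =
      fun k => coeffFbar ω c k * char k φ := by
    funext k
    by_cases hk : pair k ω = 0 <;> simp [coeffFbar, hk]
  rw [h2] at this
  exact this

theorem summable_coeffH {ω : Fin n → ℝ}
    (hc' : Summable fun k : {k : Fin n → ℤ // pair k ω ≠ 0} => ‖c k / (pair k.1 ω : ℂ)‖) :
    Summable fun k => ‖coeffH ω c k‖ := by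
  have := summable_subtype_iff_indicator (f := fun k => ‖coeffH ω c k‖)
    (s := {k | pair k ω ≠ 0})
  have h2 : ({k | pair k ω ≠ 0} : Set (Fin n → ℤ)).indicator (fun k => ‖coeffH ω c k‖) =
      fun k => ‖coeffH ω c k‖ := by
    funext k
    by_cases hk : pair k ω = 0 <;> simp [coeffH, hk]
  rw [h2] at this
  rw [← this]
  refine hc'.congr fun k => ?_
  simp [coeffH]

theorem summable_coeffFbar {ω : Fin n → ℝ} (hc : Summable fun k => ‖c k‖) :
    Summable fun k => ‖coeffFbar ω c k‖ :=
  Summable.of_nonneg_of_le (fun _ => norm_nonneg _) (fun _ => norm_indicator_le_norm_self _ _) hc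

theorem conj_coeffH {ω : Fin n → ℝ} (hreal : ∀ k, (starRingEnd ℂ) (c k) = c (-k))
    (k : Fin n → ℤ) : (starRingEnd ℂ) (coeffH ω c k) = coeffH ω c (-k) := by
  simp [coeffH, hreal, pair_neg]

theorem conj_coeffFbar {ω : Fin n → ℝ} (hreal : ∀ k, (starRingEnd ℂ) (c k) = c (-k))
    (k : Fin n → ℤ) : (starRingEnd ℂ) (coeffFbar ω c k) = coeffFbar ω c (-k) := by
  by_cases hk : pair k ω = 0 <;> simp [coeffFbar, hk, pair_neg, hreal]

/-- The homological equation, one Fourier mode at a time. -/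
theorem coeffH_mul (ω : Fin n → ℝ) (k : Fin n → ℤ) :
    coeffH ω c k * (Complex.I * (pair k ω : ℂ)) = coeffFbar ω c k - c k := by
  by_cases hk : pair k ω = 0
  · simp [coeffFbar, coeffH, hk]
  · have : Complex.I * (pair k ω : ℂ) ≠ 0 :=
      mul_ne_zero Complex.I_ne_zero (Complex.ofReal_ne_zero.2 hk)
    rw [coeffH, neg_mul, div_mul_cancel₀ _ this]
    simp [coeffFbar, hk]

theorem fourierRe_sub {a b : (Fin n → ℤ) → ℂ} (ha : Summable fun k => ‖a k‖)
    (hb : Summable fun k => ‖b k‖) (φ : Torus n) :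
    fourierRe (fun k => a k - b k) φ = fourierRe a φ - fourierRe b φ := by
  simp only [fourierRe, sub_mul]
  rw [(summable_fourier ha φ).tsum_sub (summable_fourier hb φ), Complex.sub_re]

variable {ω : Fin n → ℝ} {A : Fin n → (Fin n → ℤ) → ℂ}

theorem fieldF_apply (φ : Torus n) (j : Fin n) : fieldF A φ j = fourierRe (A j) φ := rfl

theorem fieldH_apply
    (hsum' : ∀ j, Summable fun k : {k : Fin n → ℤ // pair k ω ≠ 0} => ‖A j k / (pair k.1 ω : ℂ)‖)
    (φ : Torus n) (j : Fin n) : fieldH ω A φ j = fourierRe (coeffH ω (A j)) φ := by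
  have h := hasSum_subtype_coeffH.2 (summable_fourier (summable_coeffH (hsum' j)) φ).hasSum
  rw [fieldH, fourierRe, ← h.tsum_eq, tsum_neg]

theorem fieldFbar_apply (hsum : ∀ j, Summable fun k : Fin n → ℤ => ‖A j k‖)
    (φ : Torus n) (j : Fin n) : fieldFbar ω A φ j = fourierRe (coeffFbar ω (A j)) φ := by
  have h := hasSum_subtype_coeffFbar.2
    (summable_fourier (summable_coeffFbar (ω := ω) (hsum j)) φ).hasSum
  rw [fieldFbar, fourierRe, ← h.tsum_eq]

theorem continuous_fieldF (hsum : ∀ j, Summable fun k : Fin n → ℤ => ‖A j k‖) :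
    Continuous (fieldF A) :=
  continuous_pi fun j => continuous_fourierRe (hsum j)

theorem continuous_fieldH
    (hsum' : ∀ j, Summable fun k : {k : Fin n → ℤ // pair k ω ≠ 0} => ‖A j k / (pair k.1 ω : ℂ)‖) :
    Continuous (fieldH ω A) :=
  continuous_pi fun j => by
    simp_rw [fieldH_apply hsum']
    exact continuous_fourierRe (summable_coeffH (hsum' j))

theorem continuous_fieldFbar (hsum : ∀ j, Summable fun k : Fin n → ℤ => ‖A j k‖) :
    Continuous (fieldFbar ω A) :=
  continuous_pi fun j => by
    simp_rw [fieldFbar_apply hsum]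
    exact continuous_fourierRe (summable_coeffFbar (hsum j))

/-- The homological equation. -/
theorem hasDerivAt_fieldH (hsum : ∀ j, Summable fun k : Fin n → ℤ => ‖A j k‖)
    (hsum' : ∀ j, Summable fun k : {k : Fin n → ℤ // pair k ω ≠ 0} => ‖A j k / (pair k.1 ω : ℂ)‖)
    (φ : Torus n) : HasDerivAt (fun t : ℝ => fieldH ω A (φ + proj (t • ω)))
      (fieldFbar ω A φ - fieldF A φ) 0 := by
  rw [hasDerivAt_pi]
  intro j
  simp_rw [fieldH_apply hsum', Pi.sub_apply, fieldFbar_apply hsum, fieldF_apply]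
  have hs : Summable fun k => ‖coeffFbar ω (A j) k - A j k‖ :=
    Summable.of_nonneg_of_le (fun _ => norm_nonneg _) (fun _ => norm_sub_le _ _)
      ((summable_coeffFbar (hsum j)).add (hsum j))
  have h := hasDerivAt_fourierRe ω (summable_coeffH (hsum' j)) (by simpa only [coeffH_mul] using hs) φ
  simp_rw [coeffH_mul] at h
  rwa [fourierRe_sub (summable_coeffFbar (hsum j)) (hsum j)] at h

end Fourier

/-! ### Transfer between the torus and its cover `ℝⁿ`. -/

section Torus

variable {n : ℕ}

theorem proj_zero : proj (0 : Fin n → ℝ) = 0 := rfl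

theorem proj_add (x y : Fin n → ℝ) : proj (x + y) = proj x + proj y := rfl

theorem proj_sub (x y : Fin n → ℝ) : proj (x - y) = proj x - proj y := rfl

theorem proj_chart (φ : Torus n) : proj (chart φ) = φ := funext fun i => Real.Angle.coe_toReal (φ i)

theorem isOpenQuotientMap_proj : IsOpenQuotientMap (proj : (Fin n → ℝ) → Torus n) :=
  IsOpenQuotientMap.piMap fun _ =>
    QuotientAddGroup.isOpenQuotientMap_mk (N := AddSubgroup.zmultiples (2 * Real.pi))

theorem continuous_proj : Continuous (proj : (Fin n → ℝ) → Torus n) :=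
  isOpenQuotientMap_proj.continuous

theorem norm_chart_le (φ : Torus n) : ‖chart φ‖ ≤ Real.pi :=
  (pi_norm_le_iff_of_nonneg Real.pi_pos.le).2 fun i => Real.Angle.abs_toReal_le_pi (φ i)

theorem chart_proj {x : Fin n → ℝ} (hx : ‖x‖ < Real.pi) : chart (proj x) = x := by
  funext i
  have := abs_lt.1 ((norm_le_pi_norm x i).trans_lt hx)
  exact Real.Angle.toReal_coe_eq_self_iff.2 ⟨this.1, this.2.le⟩

theorem chart_zero : chart (0 : Torus n) = 0 := by
  rw [← proj_zero, chart_proj (by simpa using Real.pi_pos)]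

theorem eventually_chart_proj_sub {X : Type*} {l : Filter X} {x : X → Fin n → ℝ} {a : Fin n → ℝ}
    (h : Tendsto x l (𝓝 a)) : ∀ᶠ t in l, chart (proj (x t) - proj a) = x t - a := by
  filter_upwards [Metric.tendsto_nhds.1 h Real.pi Real.pi_pos] with t ht
  rw [← proj_sub, chart_proj (by rwa [← dist_eq_norm])]

/-- A continuous curve in `ℝⁿ` has the same velocity as its projection to the torus. -/
theorem hasVelocityAt_proj_iff {x : ℝ → Fin n → ℝ} {v : Fin n → ℝ} {s : ℝ}
    (hx : ContinuousAt x s) : HasVelocityAt (fun t => proj (x t)) v s ↔ HasDerivAt x v s := by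
  have h : (fun t => chart (proj (x t) - proj (x s))) =ᶠ[𝓝 s] fun t => x t - x s :=
    eventually_chart_proj_sub hx
  rw [HasVelocityAt, h.hasDerivAt_iff, hasDerivAt_sub_const_iff]

theorem HasVelocityAt.tendsto_chart {c : ℝ → Torus n} {v : Fin n → ℝ} {s : ℝ}
    (h : HasVelocityAt c v s) : Tendsto (fun t => chart (c t - c s)) (𝓝 s) (𝓝 0) := by
  have := h.continuousAt.tendsto
  rwa [sub_self, chart_zero] at this

theorem HasVelocityAt.continuousAt_curve {c : ℝ → Torus n} {v : Fin n → ℝ} {s : ℝ}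
    (h : HasVelocityAt c v s) : ContinuousAt c s := by
  have h1 : Tendsto (fun t => c s + proj (chart (c t - c s))) (𝓝 s) (𝓝 (c s + proj 0)) :=
    tendsto_const_nhds.add ((continuous_proj.tendsto 0).comp h.tendsto_chart)
  simpa [proj_chart, proj_zero, ContinuousAt] using h1

/-- Read in the chart around one of its points, a curve keeps its velocity. -/
theorem HasVelocityAt.hasDerivAt_chart {c : ℝ → Torus n} {v : Fin n → ℝ} {s : ℝ} {φ : Torus n}
    (h : HasVelocityAt c v s) (hs : ‖chart (c s - φ)‖ < Real.pi / 2) :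
    HasDerivAt (fun t => chart (c t - φ)) v s := by
  refine ((h : HasDerivAt _ _ _).const_add (chart (c s - φ))).congr_of_eventuallyEq ?_
  filter_upwards [Metric.tendsto_nhds.1 h.tendsto_chart (Real.pi / 2) (by positivity)] with t ht
  rw [dist_zero_right] at ht
  -- Two vectors of norm below `π / 2` have a sum of norm below `π`, where `chart` inverts `proj`.
  rw [← chart_proj (x := chart (c s - φ) + chart (c t - c s))
    ((norm_add_le _ _).trans_lt (by linarith)), proj_add, proj_chart, proj_chart]
  congr 1
  abel

variable {H : Torus n → Fin n → ℝ}

/-- A curve in the torus with velocity `H` is the projection of an integral curve of the lift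
of `H`. -/
theorem curve_eq_proj {K : NNReal} {Φ : (Fin n → ℝ) → ℝ → Fin n → ℝ}
    (hK : LipschitzWith K fun x => H (proj x)) (hΦ : IsGlobalFlow (fun x => H (proj x)) Φ)
    {c : ℝ → Torus n} (hc : ∀ s, HasVelocityAt c (H (c s)) s) {x : Fin n → ℝ}
    (hx : proj x = c 0) (s : ℝ) : c s = proj (Φ x s) := by
  have hcc : Continuous c := continuous_iff_continuousAt.2 fun s => (hc s).continuousAt_curve
  have hclosed : IsClosed {s | c s = proj (Φ x s)} :=
    isClosed_eq hcc (continuous_proj.comp (hΦ.continuous_curve x))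
  -- Near a time of agreement `c` lifts to `Φ x t₀ + chart (c t - c t₀)`, an integral curve of the
  -- lifted field, so it equals `Φ x` by uniqueness. Agreement is thus a clopen condition on the
  -- connected line.
  have hopen : IsOpen {s | c s = proj (Φ x s)} := by
    refine Metric.isOpen_iff.2 fun t₀ ht₀ => ?_
    obtain ⟨δ, hδ, hball⟩ := Metric.eventually_nhds_iff_ball.1
      (Metric.tendsto_nhds.1 (hc t₀).tendsto_chart (Real.pi / 2) (by positivity))
    have hproj : ∀ t, proj (Φ x t₀ + chart (c t - c t₀)) = c t := fun t => by
      rw [proj_add, proj_chart, ← (show c t₀ = proj (Φ x t₀) from ht₀)]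
      abel
    refine ⟨δ, hδ, fun t ht => ?_⟩
    rw [Real.ball_eq_Ioo] at ht hball
    have heq := ODE_solution_unique_of_mem_Ioo (v := fun _ x => H (proj x)) (s := fun _ => univ)
      (K := K) (a := t₀ - δ) (b := t₀ + δ) (t₀ := t₀) (f := fun t => Φ x t₀ + chart (c t - c t₀))
      (g := Φ x) (fun _ _ => hK.lipschitzOnWith) ⟨by linarith, by linarith⟩
      (fun t ht => ⟨by
        have := hball t ht
        rw [dist_zero_right] at this
        simp only [hproj]
        exact ((hc t).hasDerivAt_chart this).const_add _, trivial⟩)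
      (fun t _ => ⟨hΦ.deriv x t, trivial⟩) (by simp [chart_zero]) ht
    exact (hproj t).symm.trans (congrArg proj heq)
  have huniv := IsClopen.eq_univ ⟨hclosed, hopen⟩ ⟨0, by simp [hΦ.zero, hx]⟩
  exact huniv.ge (mem_univ s)

theorem periodic_of_proj_eq_zero {X : Type*} (V : Torus n → X) {p : Fin n → ℝ} (hp : proj p = 0)
    (x : Fin n → ℝ) : V (proj (x + p)) = V (proj x) := by
  rw [proj_add, hp, add_zero]

theorem exists_bound (hH : Continuous H) : ∃ M : NNReal, ∀ φ, ‖H φ‖ ≤ M := by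
  obtain ⟨M, hM⟩ := (isCompact_closedBall (0 : Fin n → ℝ) Real.pi).exists_bound_of_continuousOn
    (hH.comp continuous_proj).continuousOn
  refine ⟨M.toNNReal, fun φ => ?_⟩
  have := hM (chart φ) (by simpa using norm_chart_le φ)
  rw [Function.comp_apply, proj_chart] at this
  exact this.trans (Real.le_coe_toNNReal M)

/-- The derivative of the lift is periodic, so its bound on the compact ball containing all values
of `chart` holds everywhere. -/
theorem exists_lipschitz (hH : IsCk 1 H) : ∃ K : NNReal, LipschitzWith K fun x => H (proj x) := by
  obtain ⟨K, hK⟩ := (isCompact_closedBall (0 : Fin n → ℝ) Real.pi).exists_bound_of_continuousOn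
    (hH.continuous_fderiv (by simp)).continuousOn
  refine ⟨K.toNNReal, lipschitzWith_of_nnnorm_fderiv_le (𝕜 := ℝ)
    (hH.differentiable (by simp)) fun x => ?_⟩
  have hp : proj (chart (proj x) - x) = 0 := by rw [proj_sub, proj_chart, sub_self]
  have h1 : fderiv ℝ (fun y => H (proj y)) (x + (chart (proj x) - x)) =
      fderiv ℝ (fun y => H (proj y)) x := by
    rw [← fderiv_comp_add_right]
    congr 1
    funext y
    exact periodic_of_proj_eq_zero H hp y
  have h2 := hK (chart (proj x)) (by simpa using norm_chart_le (proj x))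
  rw [add_sub_cancel] at h1
  rw [h1] at h2
  exact_mod_cast h2.trans (Real.le_coe_toNNReal K)

/-- This makes the flow descend to the torus. -/
theorem proj_flow_eq {K : NNReal} {Φ : (Fin n → ℝ) → ℝ → Fin n → ℝ}
    (hK : LipschitzWith K fun x => H (proj x)) (hΦ : IsGlobalFlow (fun x => H (proj x)) Φ)
    {x y : Fin n → ℝ} (hxy : proj x = proj y) (s : ℝ) : proj (Φ x s) = proj (Φ y s) := by
  refine curve_eq_proj hK hΦ (c := fun s => proj (Φ x s)) (fun s => ?_) ?_ s
  · exact (hasVelocityAt_proj_iff (hΦ.continuous_curve x).continuousAt).2 (hΦ.deriv x s)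
  · rw [hΦ.zero, hxy]

/-- A function on `𝕋ⁿ × I` is continuous if its lift is. -/
theorem continuousOn_of_proj {X : Type*} [TopologicalSpace X] {W : Torus n × ℝ → X} {I : Set ℝ}
    (h : ContinuousOn (fun p : (Fin n → ℝ) × ℝ => W (proj p.1, p.2)) (univ ×ˢ I)) :
    ContinuousOn W (univ ×ˢ I) := by
  rintro ⟨φ, ε⟩ hp
  have h1 := h (chart φ, ε) ⟨trivial, hp.2⟩
  rw [ContinuousWithinAt, nhdsWithin_prod_eq, nhdsWithin_univ] at h1 ⊢
  have h2 : 𝓝 φ = map proj (𝓝 (chart φ)) := by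
    rw [isOpenQuotientMap_proj.isOpenMap.map_nhds_eq continuous_proj.continuousAt, proj_chart]
  have h3 : 𝓝 φ ×ˢ 𝓝[I] ε = map (Prod.map proj id) (𝓝 (chart φ) ×ˢ 𝓝[I] ε) := by
    rw [h2, ← prod_map_map_eq', map_id]
  rw [h3, tendsto_map'_iff]
  simp only [proj_chart] at h1
  exact h1

/-- The flow on the torus induced by the flow `Φ` of the lift of `H`. -/
def torusFlow {K : NNReal} {Φ : (Fin n → ℝ) → ℝ → Fin n → ℝ}
    (hK : LipschitzWith K fun x => H (proj x)) (hΦ : IsGlobalFlow (fun x => H (proj x)) Φ)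
    (hcont : Continuous fun q : (Fin n → ℝ) × ℝ => Φ q.1 q.2) : Flow ℝ (Torus n) where
  toFun s φ := proj (Φ (chart φ) s)
  -- `chart` is discontinuous, but the projected flow does not depend on the chosen representative,
  -- so continuity can be checked on the cover.
  cont' := by
    have h := continuousOn_of_proj (I := univ) (W := fun p : Torus n × ℝ => proj (Φ (chart p.1) p.2))
      (by
        simp only [proj_flow_eq hK hΦ (proj_chart _)]
        exact (continuous_proj.comp hcont).continuousOn)
    rw [univ_prod_univ, continuousOn_univ] at h
    exact h.comp continuous_swap
  map_add' s t φ := by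
    rw [add_comm, hΦ.add hK]
    exact proj_flow_eq hK hΦ (proj_chart _).symm s
  map_zero' φ := by rw [hΦ.zero, proj_chart]

theorem isFlowOf_torusFlow {K : NNReal} {Φ : (Fin n → ℝ) → ℝ → Fin n → ℝ}
    (hK : LipschitzWith K fun x => H (proj x)) (hΦ : IsGlobalFlow (fun x => H (proj x)) Φ)
    (hcont : Continuous fun q : (Fin n → ℝ) × ℝ => Φ q.1 q.2) :
    IsFlowOf (torusFlow hK hΦ hcont) H := fun φ s =>
  (hasVelocityAt_proj_iff (hΦ.continuous_curve (chart φ)).continuousAt).2 (hΦ.deriv (chart φ) s)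

theorem IsFlowOf.apply_proj {Γ : Flow ℝ (Torus n)} (hΓ : IsFlowOf Γ H) {K : NNReal}
    {Φ : (Fin n → ℝ) → ℝ → Fin n → ℝ}
    (hK : LipschitzWith K fun x => H (proj x)) (hΦ : IsGlobalFlow (fun x => H (proj x)) Φ)
    (x : Fin n → ℝ) (s : ℝ) : Γ s (proj x) = proj (Φ x s) :=
  curve_eq_proj hK hΦ (c := fun s => Γ s (proj x)) (hΓ _) (Γ.map_zero_apply _).symm s

theorem IsFlowOf.unique {Γ₁ Γ₂ : Flow ℝ (Torus n)} (h₁ : IsFlowOf Γ₁ H) (h₂ : IsFlowOf Γ₂ H)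
    {K : NNReal} {Φ : (Fin n → ℝ) → ℝ → Fin n → ℝ}
    (hK : LipschitzWith K fun x => H (proj x)) (hΦ : IsGlobalFlow (fun x => H (proj x)) Φ) :
    Γ₁ = Γ₂ :=
  Flow.ext fun s φ => by
    rw [← proj_chart φ, h₁.apply_proj hK hΦ, h₂.apply_proj hK hΦ]

/-- The displacement along an integral curve is bounded by the supremum of the field. -/
theorem abs_sub_le_of_lift (hH : Continuous H) {c : ℝ → Torus n}
    (hc : ∀ s, HasVelocityAt c (H (c s)) s) {x : ℝ → Fin n → ℝ} (hx : Continuous x)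
    (hxc : ∀ s, proj (x s) = c s) (ε : ℝ) (j : Fin n) :
    |x ε j - x 0 j| ≤ |ε| * supNorm fun ψ => H ψ j := by
  obtain rfl : (fun s => proj (x s)) = c := funext hxc
  have hd : ∀ s, HasDerivAt (fun s => x s j) (H (proj (x s)) j) s := fun s =>
    hasDerivAt_pi.1 ((hasVelocityAt_proj_iff hx.continuousAt).1 (hc s)) j
  obtain ⟨M, hM⟩ := exists_bound hH
  have hbdd : BddAbove (range fun ψ => |H ψ j|) :=
    ⟨M, by rintro _ ⟨ψ, rfl⟩; exact (norm_le_pi_norm (H ψ) j).trans (hM ψ)⟩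
  have := convex_univ.norm_image_sub_le_of_norm_hasDerivWithin_le
    (fun s _ => (hd s).hasDerivWithinAt) (fun s _ => le_ciSup hbdd (proj (x s)))
    (mem_univ 0) (mem_univ ε)
  rw [Real.norm_eq_abs, Real.norm_eq_abs, sub_zero, mul_comm] at this
  exact this

theorem norm_proj_le (x : Fin n → ℝ) (j : Fin n) : ‖proj x j‖ ≤ |x j| :=
  QuotientAddGroup.norm_mk_le_norm (S := AddSubgroup.zmultiples (2 * Real.pi)) (m := x j)

theorem IsFlowOf.isCkMapOn {Γ : Flow ℝ (Torus n)} (hΓ : IsFlowOf Γ H) {K : NNReal}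
    {Φ : (Fin n → ℝ) → ℝ → Fin n → ℝ}
    (hK : LipschitzWith K fun x => H (proj x)) (hΦ : IsGlobalFlow (fun x => H (proj x)) Φ)
    {m : ℕ} (hm : ContDiff ℝ m fun q : (Fin n → ℝ) × ℝ => Φ q.1 q.2) (I : Set ℝ) :
    IsCkMapOn m (fun φ ε => Γ ε φ) I := by
  intro p _
  simp only [hΓ.apply_proj hK hΦ]
  have h : ContDiffAt ℝ m (fun q : (Fin n → ℝ) × ℝ => Φ q.1 q.2 - Φ p.1 p.2) p :=
    hm.contDiffAt.sub contDiffAt_const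
  exact (h.congr_of_eventuallyEq
    (eventually_chart_proj_sub hm.continuous.continuousAt)).contDiffWithinAt

theorem IsFlowOf.torusFDeriv_proj {Γ : Flow ℝ (Torus n)} (hΓ : IsFlowOf Γ H) {K : NNReal}
    {Φ : (Fin n → ℝ) → ℝ → Fin n → ℝ}
    (hK : LipschitzWith K fun x => H (proj x)) (hΦ : IsGlobalFlow (fun x => H (proj x)) Φ)
    (hcont : Continuous fun q : (Fin n → ℝ) × ℝ => Φ q.1 q.2) (x : Fin n → ℝ) (s : ℝ) :
    torusFDeriv (Γ s) (proj x) = fderiv ℝ (fun y => Φ y s) x := by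
  have h : Tendsto (fun y => Φ (x + y) s) (𝓝 0) (𝓝 (Φ x s)) := by
    have : Continuous fun y => Φ (x + y) s :=
      hcont.comp (by fun_prop : Continuous fun y => (x + y, s))
    simpa using this.tendsto 0
  have heq : (fun y => chart (Γ s (proj x + proj y) - Γ s (proj x))) =ᶠ[𝓝 0]
      fun y => Φ (x + y) s - Φ x s := by
    simp only [← proj_add, hΓ.apply_proj hK hΦ]
    exact eventually_chart_proj_sub h
  rw [torusFDeriv, heq.fderiv_eq, fderiv_sub_const,
    fderiv_comp_add_left (f := fun y => Φ y s), add_zero]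

theorem exists_bound_on {W : Torus n × ℝ → Fin n → ℝ} {a b : ℝ}
    (h : ContinuousOn W (univ ×ˢ Icc a b)) : ∃ C : ℝ, ∀ φ, ∀ ε ∈ Icc a b, ‖W (φ, ε)‖ ≤ C := by
  obtain ⟨C, hC⟩ := ((isCompact_closedBall (0 : Fin n → ℝ) Real.pi).prod
    (isCompact_Icc (a := a) (b := b))).exists_bound_of_continuousOn
      (f := fun p : (Fin n → ℝ) × ℝ => W (proj p.1, p.2))
      (h.comp ((continuous_proj.comp continuous_fst).prodMk continuous_snd).continuousOn
        fun p hp => ⟨trivial, hp.2⟩)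
  refine ⟨C, fun φ ε hε => ?_⟩
  have := hC (chart φ, ε) ⟨by simpa using norm_chart_le φ, hε⟩
  rwa [proj_chart] at this

end Torus

/-! ### Second-order Taylor formula with a jointly continuous remainder. -/

section Taylor

variable {E F : Type*} [NormedAddCommGroup E] [NormedSpace ℝ E] [NormedAddCommGroup F]
  [NormedSpace ℝ F]

theorem hasDerivAt_snd {g : E × ℝ → F} (hg : Differentiable ℝ g) (x : E) (t : ℝ) :
    HasDerivAt (fun s => g (x, s)) (fderiv ℝ g (x, t) (0, 1)) t :=
  (hg (x, t)).hasFDerivAt.comp_hasDerivAt t ((hasDerivAt_const t x).prodMk (hasDerivAt_id t))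

theorem fderiv_fst {g : E × ℝ → F} (hg : Differentiable ℝ g) (x v : E) (t : ℝ) :
    fderiv ℝ (fun y => g (y, t)) x v = fderiv ℝ g (x, t) (v, 0) := by
  have := (hg (x, t)).hasFDerivAt.comp x (hasFDerivAt_prodMk_left (𝕜 := ℝ) x t)
  have e : fderiv ℝ (fun y => g (y, t)) x = _ := this.fderiv
  rw [e]
  rfl

/-- The remainder of second order in the Taylor expansion at `0`, divided by the square of the
variable. -/
def taylorRemainder (g : ℝ → F) (ε : ℝ) : F := ∫ t in (0 : ℝ)..1, (1 - t) • deriv (deriv g) (t * ε)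

/-- The integral form of the remainder involves no division by `ε ^ 2`, so it stays meaningful and
continuous at `ε = 0`. -/
theorem eq_taylorRemainder [CompleteSpace F] {g : ℝ → F} (hg : ContDiff ℝ 2 g) (ε : ℝ) :
    g ε = g 0 + ε • deriv g 0 + ε ^ 2 • taylorRemainder g ε := by
  have hg' : ContDiff ℝ 1 (deriv g) := by
    have : ContDiff ℝ (1 + 1) g := by simpa [one_add_one_eq_two] using hg
    exact (contDiff_succ_iff_deriv.1 this).2.2
  have hg'' : Continuous (deriv (deriv g)) := hg'.continuous_deriv (by simp)
  -- This function runs from `g 0 + ε • deriv g 0` at `t = 0` to `g ε` at `t = 1`; the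
  -- first-derivative terms cancel when it is differentiated.
  have hd : ∀ t : ℝ, HasDerivAt (fun t : ℝ => g (t * ε) + (1 - t) • ε • deriv g (t * ε))
      (ε ^ 2 • (1 - t) • deriv (deriv g) (t * ε)) t := by
    intro t
    have hm : HasDerivAt (fun t : ℝ => t * ε) ε t := by
      simpa using (hasDerivAt_id t).mul_const ε
    have h1 : HasDerivAt (fun t : ℝ => g (t * ε)) (ε • deriv g (t * ε)) t :=
      ((hg.differentiable (by simp)) (t * ε)).hasDerivAt.scomp t hm
    have h2 : HasDerivAt (fun t : ℝ => deriv g (t * ε)) (ε • deriv (deriv g) (t * ε)) t :=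
      HasDerivAt.scomp (g₁ := deriv g) t
        ((hg'.differentiable (by simp)) (t * ε)).hasDerivAt hm
    have h3 : HasDerivAt (fun t : ℝ => ε • deriv g (t * ε)) (ε • ε • deriv (deriv g) (t * ε)) t :=
      h2.const_smul ε
    have h4 := h1.add (((hasDerivAt_id t).const_sub 1).smul h3)
    refine h4.congr_deriv ?_
    simp only [id]
    module
  have hi := intervalIntegral.integral_eq_sub_of_hasDerivAt (a := 0) (b := 1) (fun t _ => hd t)
    (Continuous.intervalIntegrable (by fun_prop) _ _)
  rw [intervalIntegral.integral_smul] at hi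
  rw [taylorRemainder, hi]
  simp

theorem continuous_taylorRemainder {g : E × ℝ → F} (hg : ContDiff ℝ 2 g) :
    Continuous fun p : E × ℝ => taylorRemainder (fun s => g (p.1, s)) p.2 := by
  have h1 : ContDiff ℝ 1 fun p => fderiv ℝ g p ((0, 1) : E × ℝ) :=
    (hg.fderiv_right (by norm_num)).clm_apply contDiff_const
  have h2 : Continuous fun p => fderiv ℝ (fun p => fderiv ℝ g p ((0, 1) : E × ℝ)) p (0, 1) :=
    (h1.continuous_fderiv (by simp)).clm_apply continuous_const
  have e1 : ∀ x, deriv (fun s => g (x, s)) = fun s => fderiv ℝ g (x, s) (0, 1) := fun x =>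
    funext fun s => (hasDerivAt_snd (hg.differentiable (by simp)) x s).deriv
  have e2 : ∀ x s, deriv (deriv (fun s => g (x, s))) s =
      fderiv ℝ (fun p => fderiv ℝ g p ((0, 1) : E × ℝ)) (x, s) (0, 1) := fun x s => by
    rw [e1]
    exact (hasDerivAt_snd (h1.differentiable (by simp)) x s).deriv
  simp only [taylorRemainder, e2]
  apply intervalIntegral.continuous_parametric_intervalIntegral_of_continuous'
  exact (by fun_prop : Continuous fun q : (E × ℝ) × ℝ => 1 - q.2).smul
    (h2.comp (by fun_prop : Continuous fun q : (E × ℝ) × ℝ => (q.1.1, q.2 * q.1.2)))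

end Taylor

/-! ### Pushforward by the flow and its expansion in `ε`. -/

section Pushforward

variable {n : ℕ} {H : Torus n → Fin n → ℝ} {Γ : Flow ℝ (Torus n)} {K : NNReal}
  {Φ : (Fin n → ℝ) → ℝ → Fin n → ℝ}

theorem pushforward_add (γ : Torus n ≃ₜ Torus n) (V W : Torus n → Fin n → ℝ) (φ : Torus n) :
    pushforward γ (fun ψ => V ψ + W ψ) φ = pushforward γ V φ + pushforward γ W φ :=
  map_add _ _ _

theorem pushforward_smul (γ : Torus n ≃ₜ Torus n) (c : ℝ) (V : Torus n → Fin n → ℝ) (φ : Torus n) :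
    pushforward γ (fun ψ => c • V ψ) φ = c • pushforward γ V φ :=
  map_smul _ _ _

theorem IsFlowOf.pushforward_proj (hΓ : IsFlowOf Γ H) (hK : LipschitzWith K fun x => H (proj x))
    (hΦ : IsGlobalFlow (fun x => H (proj x)) Φ)
    (hcont : Continuous fun q : (Fin n → ℝ) × ℝ => Φ q.1 q.2) (V : Torus n → Fin n → ℝ)
    (x : Fin n → ℝ) (ε : ℝ) : pushforward (Γ.toHomeomorph ε) V (proj x) =
      fderiv ℝ (fun y => Φ y ε) (Φ x (-ε)) (V (proj (Φ x (-ε)))) := by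
  rw [pushforward, Flow.toHomeomorph_symm_apply, hΓ.apply_proj hK hΦ,
    ← hΓ.torusFDeriv_proj hK hΦ hcont]
  rfl

/-- The pushforward of a `C^m` field by a `C^(m+1)` flow is `C^m`. -/
theorem IsFlowOf.isCkOn_pushforward (hΓ : IsFlowOf Γ H)
    (hK : LipschitzWith K fun x => H (proj x)) (hΦ : IsGlobalFlow (fun x => H (proj x)) Φ) {m : ℕ}
    (hm : ContDiff ℝ (m + 1) fun q : (Fin n → ℝ) × ℝ => Φ q.1 q.2) {V : Torus n → ℝ → Fin n → ℝ}
    {I : Set ℝ} (hV : IsCkOn m V I) :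
    IsCkOn m (fun φ ε => pushforward (Γ.toHomeomorph ε) (fun ψ => V ψ ε) φ) I := by
  simp only [IsCkOn, hΓ.pushforward_proj hK hΦ hm.continuous]
  have h1 : ContDiff ℝ m fun p : (Fin n → ℝ) × ℝ => Φ p.1 (-p.2) :=
    (hm.of_le (by exact_mod_cast Nat.le_succ m)).comp (contDiff_fst.prodMk contDiff_snd.neg)
  have h2 : ContDiff ℝ m fun p : (Fin n → ℝ) × ℝ => fderiv ℝ (fun y => Φ y p.2) (Φ p.1 (-p.2)) :=
    ContDiff.fderiv (f := fun (p : (Fin n → ℝ) × ℝ) y => Φ y p.2)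
      (hm.comp (contDiff_snd.prodMk (contDiff_snd.comp contDiff_fst))) h1 le_rfl
  exact h2.contDiffOn.clm_apply
    (ContDiffOn.comp (g := fun p : (Fin n → ℝ) × ℝ => V (proj p.1) p.2) hV
      (h1.prodMk contDiff_snd).contDiffOn fun p hp => ⟨trivial, hp.2⟩)

/-- `∂_ε (Γ^ε)_* ω = D_ω H` at `ε = 0`. -/
theorem IsFlowOf.hasDerivAt_pushforward_const (hΓ : IsFlowOf Γ H)
    (hK : LipschitzWith K fun x => H (proj x)) (hΦ : IsGlobalFlow (fun x => H (proj x)) Φ)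
    (hm : ContDiff ℝ 2 fun q : (Fin n → ℝ) × ℝ => Φ q.1 q.2) {ω w x : Fin n → ℝ}
    (hw : HasDerivAt (fun t : ℝ => H (proj x + proj (t • ω))) w 0) :
    HasDerivAt (fun ε => pushforward (Γ.toHomeomorph ε) (fun _ => ω) (proj x)) w 0 := by
  have hdiff : Differentiable ℝ fun q : (Fin n → ℝ) × ℝ => Φ q.1 q.2 :=
    hm.differentiable (by simp)
  set D := fderiv ℝ fun q : (Fin n → ℝ) × ℝ => Φ q.1 q.2 with hD
  simp only [hΓ.pushforward_proj hK hΦ hm.continuous]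
  simp_rw [fun ε => fderiv_fst hdiff (Φ x (-ε)) ω ε]
  have hDd : HasFDerivAt D (fderiv ℝ D (x, 0)) (x, 0) :=
    ((hm.fderiv_right (m := 1) (by norm_num)).differentiable (by simp) (x, 0)).hasFDerivAt
  have hD0 : ∀ z v, D (z, 0) (v, 1) = v + H (proj z) := by
    intro z v
    have h1 : D (z, 0) (v, 0) = v := by
      rw [hD, ← fderiv_fst hdiff z v 0]
      have : (fun y => Φ y 0) = id := funext hΦ.zero
      rw [this, fderiv_id]
      rfl
    have h2 : D (z, 0) (0, 1) = H (proj z) := by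
      rw [(hasDerivAt_snd hdiff z 0).unique (hΦ.deriv z 0), hΦ.zero]
    rw [← h2]
    nth_rw 2 [← h1]
    rw [← map_add]
    simp
  -- The pushforward of `ω` is `D (Φ x (-ε), ε) (ω, 0)`, whose `ε`-derivative at `0` is the left
  -- side. After the swap one differentiates `D (x + t • ω, 0) (-H (proj x), 1)`, which by `hD0` is
  -- `H` along the line, minus a constant.
  have hsymm : fderiv ℝ D (x, 0) (-H (proj x), 1) (ω, 0) =
      fderiv ℝ D (x, 0) (ω, 0) (-H (proj x), 1) :=
    (hm.contDiffAt.isSymmSndFDerivAt (by simp)) _ _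
  have hw' : fderiv ℝ D (x, 0) (ω, 0) (-H (proj x), 1) = w := by
    have hline : HasDerivAt (fun t : ℝ => (x + t • ω, (0 : ℝ))) (ω, 0) 0 := by
      refine HasDerivAt.prodMk ?_ (hasDerivAt_const _ _)
      simpa using ((hasDerivAt_id (0 : ℝ)).smul_const ω).const_add x
    have h1 : HasDerivAt (fun t : ℝ => D (x + t • ω, 0)) (fderiv ℝ D (x, 0) (ω, 0)) 0 :=
      HasFDerivAt.comp_hasDerivAt (f := fun t : ℝ => (x + t • ω, (0 : ℝ))) 0 (by simpa using hDd)
        hline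
    have h2 := h1.clm_apply (hasDerivAt_const 0 (-H (proj x), (1 : ℝ)))
    simp only [hD0, map_zero, add_zero] at h2
    exact h2.unique (hw.const_add _)
  have hcurve : HasDerivAt (fun ε : ℝ => (Φ x (-ε), ε)) (-H (proj x), 1) 0 := by
    refine HasDerivAt.prodMk ?_ (hasDerivAt_id _)
    have := (hΦ.deriv x (-0)).scomp (0 : ℝ) (hasDerivAt_neg 0)
    simpa [hΦ.zero, Function.comp_def] using this
  have h1 : HasDerivAt (fun ε : ℝ => D (Φ x (-ε), ε)) (fderiv ℝ D (x, 0) (-H (proj x), 1)) 0 :=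
    HasFDerivAt.comp_hasDerivAt (f := fun ε : ℝ => (Φ x (-ε), ε)) 0
      (by simpa [hΦ.zero] using hDd) hcurve
  have h2 := h1.clm_apply (hasDerivAt_const 0 (ω, (0 : ℝ)))
  simpa only [map_zero, add_zero, hsymm, hw'] using h2

theorem IsCkOn.contDiff {m : ℕ} {V : Torus n → ℝ → Fin n → ℝ} (hV : IsCkOn m V univ) :
    ContDiff ℝ m fun p : (Fin n → ℝ) × ℝ => V (proj p.1) p.2 := by
  rwa [IsCkOn, univ_prod_univ, contDiffOn_univ] at hV

theorem IsCk.isCkOn {m : ℕ} {V : Torus n → Fin n → ℝ} (hV : IsCk m V) (I : Set ℝ) :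
    IsCkOn m (fun φ _ => V φ) I :=
  (ContDiff.comp hV contDiff_fst).contDiffOn

theorem isCkOn_const {m : ℕ} (ω : Fin n → ℝ) (I : Set ℝ) :
    IsCkOn m (fun _ _ => ω : Torus n → ℝ → Fin n → ℝ) I :=
  contDiffOn_const

theorem IsCkOn.add {m : ℕ} {V W : Torus n → ℝ → Fin n → ℝ} {I : Set ℝ} (hV : IsCkOn m V I)
    (hW : IsCkOn m W I) : IsCkOn m (fun φ ε => V φ ε + W φ ε) I :=
  ContDiffOn.add hV hW

theorem IsCkOn.pow_smul {m : ℕ} {V : Torus n → ℝ → Fin n → ℝ} {I : Set ℝ} (hV : IsCkOn m V I)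
    (k : ℕ) : IsCkOn m (fun φ ε => ε ^ k • V φ ε) I :=
  ContDiffOn.smul (contDiff_snd.pow k).contDiffOn hV

theorem IsFlowOf.pushforward_zero (hΓ : IsFlowOf Γ H)
    (hK : LipschitzWith K fun x => H (proj x)) (hΦ : IsGlobalFlow (fun x => H (proj x)) Φ)
    (hcont : Continuous fun q : (Fin n → ℝ) × ℝ => Φ q.1 q.2) (V : Torus n → Fin n → ℝ)
    (φ : Torus n) : pushforward (Γ.toHomeomorph 0) V φ = V φ := by
  obtain ⟨x, rfl⟩ := isOpenQuotientMap_proj.surjective φ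
  rw [hΓ.pushforward_proj hK hΦ hcont, neg_zero, hΦ.zero,
    show (fun y => Φ y 0) = id from funext hΦ.zero, fderiv_id]
  rfl

/-- The pushforward of `ω + ε F + ε² R` by the flow of `H` is `ω + ε (F + D_ω H) + O(ε²)`. -/
theorem IsFlowOf.exists_remainder (hΓ : IsFlowOf Γ H)
    (hK : LipschitzWith K fun x => H (proj x)) (hΦ : IsGlobalFlow (fun x => H (proj x)) Φ)
    (hm : ContDiff ℝ 3 fun q : (Fin n → ℝ) × ℝ => Φ q.1 q.2) {ω : Fin n → ℝ}
    {F Fbar : Torus n → Fin n → ℝ} (hF : IsCk 2 F)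
    (hw : ∀ φ, HasDerivAt (fun t : ℝ => H (φ + proj (t • ω))) (Fbar φ - F φ) 0)
    {R : Torus n → ℝ → Fin n → ℝ} {a b : ℝ} (hR : IsCkOn 2 R (Icc a b)) :
    ∃ Rbar : Torus n → ℝ → Fin n → ℝ,
      ContinuousOn (fun p : Torus n × ℝ => Rbar p.1 p.2) (univ ×ˢ Icc a b) ∧
      (∃ C : ℝ, ∀ φ, ∀ ε ∈ Icc a b, ‖Rbar φ ε‖ ≤ C) ∧
      ∀ φ ε, pushforward (Γ.toHomeomorph ε) (fun ψ => ω + ε • F ψ + ε ^ 2 • R ψ ε) φ =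
        ω + ε • Fbar φ + ε ^ 2 • Rbar φ ε := by
  have hm3 : ContDiff ℝ ((2 : ℕ) + 1) fun q : (Fin n → ℝ) × ℝ => Φ q.1 q.2 := by
    convert hm using 1
    norm_num
  let Q : Torus n → ℝ → Fin n → ℝ := fun φ ε => pushforward (Γ.toHomeomorph ε) F φ
  -- `R` is left out because it is smooth only on `Icc a b`; without it the pushforward is `C²` for
  -- all real `ε`, and ordinary derivatives at `0` can be used.
  let G : Torus n → ℝ → Fin n → ℝ := fun φ ε =>
    pushforward (Γ.toHomeomorph ε) (fun ψ => ω + ε • F ψ) φ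
  have hQ : IsCkOn 2 Q univ := hΓ.isCkOn_pushforward hK hΦ hm3 (hF.isCkOn univ)
  have hG : IsCkOn 2 G univ := hΓ.isCkOn_pushforward hK hΦ hm3 (V := fun ψ ε => ω + ε • F ψ)
    ((isCkOn_const ω univ).add (by simpa using (hF.isCkOn univ).pow_smul 1))
  have hQd : ∀ x, ContDiff ℝ 2 (Q (proj x)) := fun x =>
    hQ.contDiff.comp (contDiff_prodMk_right x)
  have hGd : ∀ x, ContDiff ℝ 2 (G (proj x)) := fun x =>
    hG.contDiff.comp (contDiff_prodMk_right x)
  have hG0 : ∀ φ, G φ 0 = ω := fun φ => by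
    simp [G, hΓ.pushforward_zero hK hΦ hm.continuous]
  have hG1 : ∀ φ, deriv (G φ) 0 = Fbar φ := by
    intro φ
    obtain ⟨x, rfl⟩ := isOpenQuotientMap_proj.surjective φ
    have h1 := hΓ.hasDerivAt_pushforward_const hK hΦ (hm.of_le (by norm_num)) (hw (proj x))
    have h2 := (hasDerivAt_id (0 : ℝ)).smul (((hQd x).differentiable (by simp)) 0).hasDerivAt
    have h3 := h1.add h2
    have e : G (proj x) = (fun ε => pushforward (Γ.toHomeomorph ε) (fun _ => ω) (proj x)) +
        fun ε => id ε • Q (proj x) ε := by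
      funext ε
      simp [G, Q, pushforward_add, pushforward_smul]
    rw [e]
    refine h3.deriv.trans ?_
    simp [Q, hΓ.pushforward_zero hK hΦ hm.continuous]
  -- By linearity the `ε ^ 2 • R` term contributes its own pushforward, which needs no expansion.
  let Rbar : Torus n → ℝ → Fin n → ℝ := fun φ ε =>
    taylorRemainder (G φ) ε + pushforward (Γ.toHomeomorph ε) (fun ψ => R ψ ε) φ
  have hcont : ContinuousOn (fun p : Torus n × ℝ => Rbar p.1 p.2) (univ ×ˢ Icc a b) := by
    refine continuousOn_of_proj (W := fun p : Torus n × ℝ => Rbar p.1 p.2) ?_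
    exact (continuous_taylorRemainder hG.contDiff).continuousOn.add
      (ContDiffOn.continuousOn (hΓ.isCkOn_pushforward hK hΦ hm3 hR))
  refine ⟨Rbar, hcont, exists_bound_on hcont, fun φ ε => ?_⟩
  have hT : G φ ε = ω + ε • Fbar φ + ε ^ 2 • taylorRemainder (G φ) ε := by
    obtain ⟨x, rfl⟩ := isOpenQuotientMap_proj.surjective φ
    rw [eq_taylorRemainder (hGd x) ε, hG0, hG1]
  rw [pushforward_add, pushforward_smul, smul_add, ← add_assoc, ← hT]

end Pushforward

end PhaseNF

end

/-! ### Assembly of the theorem. -/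

theorem mainTheorem4 (n : ℕ) (ω : Fin n → ℝ) (A : Fin n → (Fin n → ℤ) → ℂ)
    (hreal : ∀ j k, (starRingEnd ℂ) (A j k) = A j (-k))
    (hsum : ∀ j, Summable fun k : Fin n → ℤ => ‖A j k‖)
    (hsum' : ∀ j, Summable fun k : {k : Fin n → ℤ // PhaseNF.pair k ω ≠ 0} =>
      ‖A j k / (PhaseNF.pair k.1 ω : ℂ)‖) :
    -- the Fourier series converge to real-valued continuous vector fields
    ((∀ j φ, HasSum (fun k : Fin n → ℤ => A j k * PhaseNF.char k φ)
        (PhaseNF.fieldF A φ j : ℂ)) ∧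
      (∀ j φ, HasSum (fun k : {k : Fin n → ℤ // PhaseNF.pair k ω ≠ 0} =>
          -(A j k / (Complex.I * (PhaseNF.pair k.1 ω : ℂ)) * PhaseNF.char k.1 φ))
        (PhaseNF.fieldH ω A φ j : ℂ)) ∧
      (∀ j φ, HasSum (fun k : {k : Fin n → ℤ // PhaseNF.pair k ω = 0} =>
          A j k * PhaseNF.char k.1 φ)
        (PhaseNF.fieldFbar ω A φ j : ℂ)) ∧
      Continuous (PhaseNF.fieldF A) ∧
      Continuous (PhaseNF.fieldH ω A) ∧
      Continuous (PhaseNF.fieldFbar ω A) ∧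
      -- the homological equation
      ∀ φ, PhaseNF.DirDifferentiableAt ω (PhaseNF.fieldH ω A) φ ∧
        PhaseNF.fieldFbar ω A φ =
          PhaseNF.fieldF A φ + PhaseNF.dirDeriv ω (PhaseNF.fieldH ω A) φ) ∧
    -- the normal form transformation
    ∀ (ε₀ : ℝ) (R : PhaseNF.Torus n → ℝ → Fin n → ℝ), 0 < ε₀ →
      PhaseNF.IsCk 2 (PhaseNF.fieldF A) →
      PhaseNF.IsCk 3 (PhaseNF.fieldH ω A) →
      PhaseNF.IsCkOn 2 R (Set.Icc (-ε₀) ε₀) →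
      (∃! Γ : Flow ℝ (PhaseNF.Torus n), PhaseNF.IsFlowOf Γ (PhaseNF.fieldH ω A)) ∧
      ∀ Γ : Flow ℝ (PhaseNF.Torus n), PhaseNF.IsFlowOf Γ (PhaseNF.fieldH ω A) →
        -- the flow is `C³` and close to the identity, in the torus and along lifted flow lines
        PhaseNF.IsCkMapOn 3 (fun φ ε => Γ ε φ) (Set.Icc (-ε₀) ε₀) ∧
        (∀ ε ∈ Set.Icc (-ε₀) ε₀, ∀ (φ : PhaseNF.Torus n) (j : Fin n),
          ‖Γ ε φ j - φ j‖ ≤ |ε| * PhaseNF.supNorm (fun ψ => PhaseNF.fieldH ω A ψ j) ∧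
          ∀ x : ℝ → Fin n → ℝ, Continuous x → (∀ s, PhaseNF.proj (x s) = Γ s φ) →
            |x ε j - x 0 j| ≤ |ε| * PhaseNF.supNorm (fun ψ => PhaseNF.fieldH ω A ψ j)) ∧
        -- the pushforward of `F(·, ε) = ω + ε F⁽¹⁾ + ε² R(·, ε)`
        PhaseNF.IsCkOn 2
          (fun φ ε => PhaseNF.pushforward (Γ.toHomeomorph ε)
            (fun ψ => ω + ε • PhaseNF.fieldF A ψ + ε ^ 2 • R ψ ε) φ) (Set.Icc (-ε₀) ε₀) ∧
        ∃ Rbar : PhaseNF.Torus n → ℝ → Fin n → ℝ,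
          ContinuousOn (fun p : PhaseNF.Torus n × ℝ => Rbar p.1 p.2)
            (Set.univ ×ˢ Set.Icc (-ε₀) ε₀) ∧
          (∃ C : ℝ, ∀ φ, ∀ ε ∈ Set.Icc (-ε₀) ε₀, ‖Rbar φ ε‖ ≤ C) ∧
          ∀ φ, ∀ ε ∈ Set.Icc (-ε₀) ε₀,
            PhaseNF.pushforward (Γ.toHomeomorph ε)
                (fun ψ => ω + ε • PhaseNF.fieldF A ψ + ε ^ 2 • R ψ ε) φ =
              ω + ε • PhaseNF.fieldFbar ω A φ + ε ^ 2 • Rbar φ ε := by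
  open PhaseNF in
  refine ⟨⟨fun j φ => hasSum_fourierRe (hreal j) (hsum j) φ, fun j φ => ?_, fun j φ => ?_,
    continuous_fieldF hsum, continuous_fieldH hsum', continuous_fieldFbar hsum, fun φ => ?_⟩, ?_⟩
  · rw [fieldH_apply hsum', hasSum_subtype_coeffH]
    exact hasSum_fourierRe (conj_coeffH (hreal j)) (summable_coeffH (hsum' j)) φ
  · rw [fieldFbar_apply hsum, hasSum_subtype_coeffFbar]
    exact hasSum_fourierRe (conj_coeffFbar (hreal j)) (summable_coeffFbar (hsum j)) φ
  · have h := hasDerivAt_fieldH hsum hsum' φ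
    refine ⟨h.differentiableAt, ?_⟩
    rw [dirDeriv, h.deriv, add_sub_cancel]
  intro ε₀ R _ hF hH hR
  have hHc := continuous_fieldH hsum'
  obtain ⟨M, hM⟩ := exists_bound hHc
  obtain ⟨K, hK⟩ := exists_lipschitz (hH.of_le (by norm_num))
  obtain ⟨Φ, hΦ⟩ := exists_isGlobalFlow hK fun x => hM (proj x)
  have hΦ3 : ContDiff ℝ 3 fun q : (Fin n → ℝ) × ℝ => Φ q.1 q.2 :=
    hΦ.contDiff hK (m := 3) (by norm_num) hH
  have hex := isFlowOf_torusFlow hK hΦ hΦ3.continuous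
  refine ⟨⟨_, hex, fun Γ hΓ => hΓ.unique hex hK hΦ⟩, fun Γ hΓ => ?_⟩
  obtain ⟨Rbar, hcont, hbdd, heq⟩ := hΓ.exists_remainder hK hΦ hΦ3 hF
    (hasDerivAt_fieldH hsum hsum') hR
  refine ⟨hΓ.isCkMapOn hK hΦ hΦ3 _, fun ε _ φ j => ⟨?_, fun x hx hxΓ => ?_⟩, ?_,
    Rbar, hcont, hbdd, fun φ ε _ => heq φ ε⟩
  · obtain ⟨x, rfl⟩ := isOpenQuotientMap_proj.surjective φ
    have h := abs_sub_le_of_lift hHc (c := fun s => Γ s (proj x)) (hΓ (proj x))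
      (hΦ.continuous_curve x) (fun s => (hΓ.apply_proj hK hΦ x s).symm) ε j
    -- The torus distance is the quotient norm of the displacement of the lifted curve, hence at
    -- most its absolute value.
    rw [hΓ.apply_proj hK hΦ, ← Pi.sub_apply, ← proj_sub]
    rw [hΦ.zero] at h
    exact (norm_proj_le _ j).trans h
  · exact abs_sub_le_of_lift hHc (hΓ φ) hx hxΓ ε j
  · exact hΓ.isCkOn_pushforward hK hΦ (m := 2) (by convert hΦ3 using 1; norm_num)
      (((isCkOn_const ω _).add (by simpa using (hF.isCkOn _).pow_smul 1)).add (hR.pow_smul 2))
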